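/- **Setting.** An *ontology* $\mathcal T$ is a finite set of tuple-generating dependencies $\forall \vec x\,(\varphi(\vec x)\to\exists\vec y\,\bigwedge_i\psi_i(\vec x,\vec y))$, where $\varphi$ and the $\psi_i$ are unary or binary atoms without constants and $|\vec x\cup\vec y|\le 2$; its size $|\mathcal T|$ is the number of predicate occurrences in it. A *conjunctive query* (CQ) is a formula $\boldsymbol q(\vec x)=\exists\vec y\,\varphi(\vec x,\vec y)$, where $\varphi$ is a conjunction of unary and binary atoms without constants; its size $|\boldsymbol q|$ is the number of its quantifiers and atoms. A *data instance* $\mathcal A$ is a finite set of unary and binary ground atoms; $\mathsf{ind}(\mathcal A)$ is the set of constants in it. We write $\mathcal T,\mathcal A\models\boldsymbol q(\vec a)$ if $\boldsymbol q(\vec a)$ is true in every model of $\mathcal T$ and $\mathcal A$. The instance $\mathcal A$ is *complete* for $\mathcal T$ if it contains every ground atom over $\mathsf{ind}(\mathcal A)$ that is entailed by $\mathcal T$ and $\mathcal A$. An *FO-rewriting* of $\boldsymbol q(\vec x)$ and $\mathcal T$ is a first-order formula $\boldsymbol q'(\vec x)$ with equality and without constants such that, for every complete data instance $\mathcal A$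 and every tuple $\vec a$ from $\mathsf{ind}(\mathcal A)$, we have $\mathcal T,\mathcal A\models\boldsymbol q(\vec a)$ iff $\boldsymbol q'(\vec a)$ is true in $\mathcal A$ regarded as a structure with domain $\mathsf{ind}(\mathcal A)$. The size of $\boldsymbol q'$ is its number of symbols. For a formula $\varrho(x)$ of the form $S(x)$, $S(x,x)$, $\exists y\,S(x,y)$ or $\exists y\,S(y,x)$, with $S$ a predicate in $\mathcal T$, let $\mathcal C_{\mathcal T}^{\varrho(a)}$ be a (standard) chase of $\{A(a)\}$ with $\mathcal T\cup\{A(x)\to\varrho(x)\}$, where $A$ is a fresh unary predicate; its elements are $a$ and the labelled nulls introduced by existential quantifiers. The ontology $\mathcal T$ is *of depth $1$* if the chases $\mathcal C_{\mathcal T}^{\varrho(a)}$ can be chosen so that at least one of them contains a binary atom with a labelled null as an argument, and none of them contains a binary atom both of whose arguments are (not necessarily distinct) labelled nulls. $\mathsf{NL}/\mathrm{poly}$ is the class of sequences $f=(f_n)_{n\ge0}$ of Boolean functions $f_n\colon\{0,1\}^n\to\{0,1\}$ computed by nondeterministic Turing machines using $O(\log n)$ cells of work tape and advice of polynomial length that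 depends only on $n$. $\mathsf{NC}^1$ is the (nonuniform) class of sequences computed by Boolean circuits of fan-in at most $2$, polynomial size and depth $O(\log n)$. **Theorem.** The following are equivalent: 1. There is a polynomial $P$ such that every CQ $\boldsymbol q$ and every ontology $\mathcal T$ of depth $1$ have an FO-rewriting of size at most $P(|\boldsymbol q|+|\mathcal T|)$. 2. Every sequence of Boolean functions in $\mathsf{NL}/\mathrm{poly}$ is computed by Boolean formulas (over $\neg,\wedge,\vee$ and constants) of polynomial size. 3. $\mathsf{NL}/\mathrm{poly}\subseteq\mathsf{NC}^1$. -/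

import Mathlib

namespace OBDA

/-! ### Atoms, tgds, ontologies, data, conjunctive queries -/

/-- Unary and binary atoms over a set `V` of arguments (variables, individuals or domain elements).
Predicate names are natural numbers, separately for each arity. -/
inductive Atom (V : Type) : Type
  | un (p : ℕ) (x : V) : Atom V
  | bin (p : ℕ) (x y : V) : Atom V
  deriving DecidableEq

namespace Atom

/-- Apply a map to the arguments of an atom. -/
def map {V W : Type} (h : V → W) : Atom V → Atom W
  | un p x => un p (h x)
  | bin p x y => bin p (h x) (h y)

/-- The set of arguments of an atom. -/
def args {V : Type} : Atom V → Set V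
  | un _ x => {x}
  | bin _ x y => {x, y}

/-- The predicate of an atom: `Sum.inl p` for a unary `p`, `Sum.inr p` for a binary `p`. -/
def pred {V : Type} : Atom V → ℕ ⊕ ℕ
  | un p _ => Sum.inl p
  | bin p _ _ => Sum.inr p

end Atom

/-- The set of all arguments occurring in a set of atoms. -/
def dom {V : Type} (I : Set (Atom V)) : Set V :=
  {x | ∃ α ∈ I, x ∈ α.args}

/-- A tuple-generating dependency `∀ x (φ(x) → ∃ y ⋀ᵢ ψᵢ(x, y))` with at most two variables
altogether (named `0` and `1`). The variables of the body are universally quantified; a variable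
that does not occur in the body is existentially quantified in the head. -/
structure Tgd : Type where
  body : Atom (Fin 2)
  head : List (Atom (Fin 2))
  deriving DecidableEq

/-- `g` maps the head of `τ` into `I` and agrees with `h` on the universally quantified variables:
the trigger `(τ, h)` is satisfied in `I`. -/
def Tgd.TriggerSat {D : Type} (τ : Tgd) (I : Set (Atom D)) (h : Fin 2 → D) : Prop :=
  ∃ g : Fin 2 → D, (∀ v ∈ τ.body.args, g v = h v) ∧ ∀ ψ ∈ τ.head, ψ.map g ∈ I

/-- The interpretation with domain `D` and set of true atoms `I` satisfies the tgd `τ`. -/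
def Tgd.Sat {D : Type} (τ : Tgd) (I : Set (Atom D)) : Prop :=
  ∀ h : Fin 2 → D, τ.body.map h ∈ I → τ.TriggerSat I h

/-- The number of predicate occurrences in a tgd. -/
def Tgd.size (τ : Tgd) : ℕ := 1 + τ.head.length

/-- An ontology is a finite set of tgds. -/
abbrev Ontology : Type := Finset Tgd

/-- The number of predicate occurrences in an ontology. -/
def Ontology.size (T : Ontology) : ℕ := ∑ τ ∈ T, τ.size

/-- The predicates occurring in an ontology. -/
def Ontology.preds (T : Ontology) : Set (ℕ ⊕ ℕ) :=
  {s | ∃ τ ∈ T, s = τ.body.pred ∨ ∃ ψ ∈ τ.head, s = ψ.pred}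

/-- A data instance is a finite set of ground atoms; individual constants are natural numbers. -/
abbrev Data : Type := Finset (Atom ℕ)

/-- The individual constants occurring in a data instance. -/
def Data.ind (A : Data) : Set ℕ := dom (A : Set (Atom ℕ))

/-- A conjunctive query `∃ y φ(x, y)` with answer variables `x` indexed by `Fin m` and
existentially quantified variables `y` indexed by `Fin numEx`. -/
structure CQ (m : ℕ) : Type where
  numEx : ℕ
  atoms : List (Atom (Fin m ⊕ Fin numEx))

/-- The size of a CQ: the number of its quantifiers and atoms. -/
def CQ.size {m : ℕ} (q : CQ m) : ℕ := q.numEx + q.atoms.length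

/-- `I ⊨ q(a)`. -/
def CQ.Holds {m : ℕ} (q : CQ m) {D : Type} (I : Set (Atom D)) (a : Fin m → D) : Prop :=
  ∃ b : Fin q.numEx → D, ∀ α ∈ q.atoms, α.map (Sum.elim a b) ∈ I

/-- The interpretation with domain `D`, true atoms `I` and constants interpreted by `c` is a model
of the knowledge base `(T, A)`. -/
def IsModel (T : Ontology) (A : Data) {D : Type} (I : Set (Atom D)) (c : ℕ → D) : Prop :=
  (∀ τ ∈ T, τ.Sat I) ∧ ∀ α ∈ A, α.map c ∈ I

/-- `T, A ⊨ q(a)`: the tuple `a` is a certain answer to `q` over `(T, A)`. -/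
def CertainAnswer (T : Ontology) (A : Data) {m : ℕ} (q : CQ m) (a : Fin m → ℕ) : Prop :=
  ∀ (D : Type) (I : Set (Atom D)) (c : ℕ → D), IsModel T A I c → q.Holds I (fun i => c (a i))

/-- `A` contains every ground atom over its individuals that is entailed by `(T, A)`. -/
def IsComplete (T : Ontology) (A : Data) : Prop :=
  ∀ α : Atom ℕ, α.args ⊆ A.ind →
    (∀ (D : Type) (I : Set (Atom D)) (c : ℕ → D), IsModel T A I c → α.map c ∈ I) → α ∈ A

/-! ### First-order rewritings -/

/-- The relation symbols of the first-order vocabulary of unary and binary predicates. -/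
inductive VocRel : ℕ → Type
  | un (p : ℕ) : VocRel 1
  | bin (p : ℕ) : VocRel 2

/-- The first-order vocabulary of unary and binary predicates, without constants and functions. -/
def Voc : FirstOrder.Language := ⟨fun _ => Empty, VocRel⟩

/-- A set of atoms over `D` as a first-order structure with domain `D`. -/
@[reducible] def toStructure {D : Type} (I : Set (Atom D)) : Voc.Structure D where
  funMap := fun f _ => Empty.elim f
  RelMap := fun {_} R =>
    match R with
    | .un p => fun v => Atom.un p (v 0) ∈ I
    | .bin p => fun v => Atom.bin p (v 0) (v 1) ∈ I

/-- `A ⊨ φ(a)`, where a data instance `A` is regarded as a first-order structure with domain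
`ind(A)`. -/
def Data.Models (A : Data) {m : ℕ} (φ : Voc.Formula (Fin m)) (a : Fin m → A.ind) : Prop :=
  letI : Voc.Structure A.ind := toStructure {α | α.map Subtype.val ∈ A}
  φ.Realize a

/-- The number of symbols in a first-order formula. -/
def foSize {V : Type} : {n : ℕ} → Voc.BoundedFormula V n → ℕ
  | _, .falsum => 1
  | _, .equal _ _ => 3
  | _, @FirstOrder.Language.BoundedFormula.rel _ _ _ l _ _ => l + 1
  | _, .imp φ ψ => foSize φ + foSize ψ + 1
  | _, .all φ => foSize φ + 1

/-- `φ` is an FO-rewriting of `q` and `T` (over complete data instances). -/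
def IsFORewriting (T : Ontology) {m : ℕ} (q : CQ m) (φ : Voc.Formula (Fin m)) : Prop :=
  ∀ A : Data, IsComplete T A → ∀ a : Fin m → A.ind,
    CertainAnswer T A q (fun i => (a i : ℕ)) ↔ A.Models φ a

/-! ### The chase and ontologies of depth 1

Elements of a chase are individuals `Sum.inl a` and labelled nulls `Sum.inr n`. -/

/-- One step of the (standard) chase: a tgd is applied to a trigger that is not yet satisfied, with
a fresh labelled null for the existentially quantified variable (if there is one). -/
def ChaseStep (T : Ontology) (I J : Set (Atom (ℕ ⊕ ℕ))) : Prop :=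
  ∃ τ ∈ T, ∃ g : Fin 2 → ℕ ⊕ ℕ, τ.body.map g ∈ I ∧ ¬ τ.TriggerSat I g ∧
    (∀ v, v ∉ τ.body.args → ∃ n : ℕ, g v = Sum.inr n ∧ Sum.inr n ∉ dom I) ∧
    J = I ∪ {α | ∃ ψ ∈ τ.head, α = ψ.map g}

/-- `C` is the result of chasing `A` with `T`: the union of a finite or infinite sequence of chase
steps in which every trigger is eventually satisfied. -/
def IsChase (T : Ontology) (A : Data) (C : Set (Atom (ℕ ⊕ ℕ))) : Prop :=
  ∃ I : ℕ → Set (Atom (ℕ ⊕ ℕ)),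
    I 0 = {α | ∃ β ∈ A, α = β.map Sum.inl} ∧
    (∀ k, I (k + 1) = I k ∨ ChaseStep T (I k) (I (k + 1))) ∧
    C = (⋃ k, I k) ∧ ∀ τ ∈ T, τ.Sat C

/-- The formulas `ϱ(x)` of the form `S(x)`, `S(x,x)`, `∃ y S(x,y)` and `∃ y S(y,x)`, where `S` is a
predicate in `T`; here `x` is the variable `0` and `y` is the variable `1`. -/
def Ontology.generators (T : Ontology) : Set (Atom (Fin 2)) :=
  {ϱ | ϱ.pred ∈ T.preds ∧ ∃ p : ℕ,
    ϱ = .un p 0 ∨ ϱ = .bin p 0 0 ∨ ϱ = .bin p 0 1 ∨ ϱ = .bin p 1 0}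

/-- `C` is a chase of the knowledge base `(T ∪ {A(x) → ϱ(x)}, {A(a)})`, where `A` is a fresh unary
predicate and `a` is the individual `0`. -/
def IsGeneratedChase (T : Ontology) (ϱ : Atom (Fin 2)) (C : Set (Atom (ℕ ⊕ ℕ))) : Prop :=
  ∃ A : ℕ, Sum.inl A ∉ T.preds ∧ Sum.inl A ≠ ϱ.pred ∧
    IsChase (insert ⟨.un A 0, [ϱ]⟩ T) {.un A 0} C

/-- `C` contains a chain `w₀, w₁, …, w_k` (with not necessarily distinct elements) in which
consecutive elements are connected by a binary atom, in one direction or the other, and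
`w₁, …, w_k` are labelled nulls. -/
def HasChain (C : Set (Atom (ℕ ⊕ ℕ))) (k : ℕ) : Prop :=
  ∃ w : ℕ → ℕ ⊕ ℕ, ∀ i < k, (∃ n : ℕ, w (i + 1) = Sum.inr n) ∧
    ∃ R : ℕ, Atom.bin R (w i) (w (i + 1)) ∈ C ∨ Atom.bin R (w (i + 1)) (w i) ∈ C

/-- `T` is of depth 1: one of the chases generated by the `ϱ(a)` contains a chain with one
labelled null, and none of them contains a chain with two labelled nulls. -/
def Ontology.IsDepthOne (T : Ontology) : Prop :=
  ∃ C : Atom (Fin 2) → Set (Atom (ℕ ⊕ ℕ)),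
    (∀ ϱ ∈ T.generators, IsGeneratedChase T ϱ (C ϱ)) ∧
    (∃ ϱ ∈ T.generators, HasChain (C ϱ) 1) ∧
    ∀ ϱ ∈ T.generators, ¬ HasChain (C ϱ) 2

/-- All CQs and ontologies of depth 1 have FO-rewritings of size polynomial in the size of the CQ
and the ontology. -/
def PolySizeFORewritingsDepthOne : Prop :=
  ∃ P : Polynomial ℕ, ∀ (T : Ontology) (m : ℕ) (q : CQ m), T.IsDepthOne →
    ∃ φ : Voc.Formula (Fin m), IsFORewriting T q φ ∧ foSize φ ≤ P.eval (q.size + T.size)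

/-! ### Boolean formulas and circuits -/

/-- A sequence of Boolean functions, one for each number of variables. -/
abbrev BoolFamily : Type := ∀ n : ℕ, (Fin n → Bool) → Bool

/-- Boolean formulas in `n` variables. -/
inductive BoolFormula (n : ℕ) : Type
  | const (b : Bool) : BoolFormula n
  | var (i : Fin n) : BoolFormula n
  | neg (φ : BoolFormula n) : BoolFormula n
  | conj (φ ψ : BoolFormula n) : BoolFormula n
  | disj (φ ψ : BoolFormula n) : BoolFormula n

namespace BoolFormula

/-- The value of a formula under an assignment. -/
def eval {n : ℕ} (x : Fin n → Bool) : BoolFormula n → Bool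
  | const b => b
  | var i => x i
  | neg φ => !(φ.eval x)
  | conj φ ψ => φ.eval x && ψ.eval x
  | disj φ ψ => φ.eval x || ψ.eval x

/-- The number of occurrences of variables, constants and connectives. -/
def size {n : ℕ} : BoolFormula n → ℕ
  | const _ => 1
  | var _ => 1
  | neg φ => φ.size + 1
  | conj φ ψ => φ.size + ψ.size + 1
  | disj φ ψ => φ.size + ψ.size + 1

end BoolFormula

/-- The families of Boolean functions computed by polynomial-size Boolean formulas. -/
def PolyFormula : Set BoolFamily :=
  {f | ∃ P : Polynomial ℕ, ∀ n, ∃ φ : BoolFormula n,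
    φ.size ≤ P.eval n ∧ ∀ x, φ.eval x = f n x}

/-- The nodes of a circuit with `n` inputs; the gates take their arguments among the nodes
with numbers less than `i`. -/
inductive Gate (n i : ℕ) : Type
  | const (b : Bool) : Gate n i
  | input (k : Fin n) : Gate n i
  | not (j : Fin i) : Gate n i
  | and (j k : Fin i) : Gate n i
  | or (j k : Fin i) : Gate n i

/-- Boolean circuits with `n` inputs and gates of fan-in at most two. -/
structure Circuit (n : ℕ) : Type where
  size : ℕ
  gate : ∀ i : Fin size, Gate n i
  output : Fin size

namespace Circuit

/-- The value of a node of a circuit. -/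
def val {n : ℕ} (C : Circuit n) (x : Fin n → Bool) (i : Fin C.size) : Bool :=
  match C.gate i with
  | .const b => b
  | .input k => x k
  | .not j => !(C.val x ⟨j, j.isLt.trans i.isLt⟩)
  | .and j k => C.val x ⟨j, j.isLt.trans i.isLt⟩ && C.val x ⟨k, k.isLt.trans i.isLt⟩
  | .or j k => C.val x ⟨j, j.isLt.trans i.isLt⟩ || C.val x ⟨k, k.isLt.trans i.isLt⟩
termination_by i.val
decreasing_by all_goals exact Fin.isLt _

/-- The depth of a node: the length of the longest path from the node to an input or constant. -/
def nodeDepth {n : ℕ} (C : Circuit n) (i : Fin C.size) : ℕ :=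
  match C.gate i with
  | .const _ => 0
  | .input _ => 0
  | .not j => C.nodeDepth ⟨j, j.isLt.trans i.isLt⟩ + 1
  | .and j k =>
      max (C.nodeDepth ⟨j, j.isLt.trans i.isLt⟩) (C.nodeDepth ⟨k, k.isLt.trans i.isLt⟩) + 1
  | .or j k =>
      max (C.nodeDepth ⟨j, j.isLt.trans i.isLt⟩) (C.nodeDepth ⟨k, k.isLt.trans i.isLt⟩) + 1
termination_by i.val
decreasing_by all_goals exact Fin.isLt _

/-- The value of the output node. -/
def eval {n : ℕ} (C : Circuit n) (x : Fin n → Bool) : Bool := C.val x C.output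

/-- The depth of a circuit. -/
def depth {n : ℕ} (C : Circuit n) : ℕ := C.nodeDepth C.output

end Circuit

/-- (Nonuniform) `NC¹`: families of Boolean functions computed by circuits of fan-in at most two,
polynomial size and logarithmic depth. -/
def NC1 : Set BoolFamily :=
  {f | ∃ (P : Polynomial ℕ) (c : ℕ), ∀ n, ∃ C : Circuit n,
    C.size ≤ P.eval n ∧ C.depth ≤ c * (Nat.log 2 n + 1) ∧ ∀ x, C.eval x = f n x}

/-! ### Nondeterministic logarithmic space with polynomial advice -/

/-- Symbols on a read-only tape: bits between two end markers. -/
inductive TapeSym : Type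
  | left : TapeSym
  | bit (b : Bool) : TapeSym
  | right : TapeSym

/-- The symbol in cell `i` of a read-only tape containing the word `u`: the word occupies the cells
`1, …, |u|` between the end markers in the cells `0` and `|u| + 1`. -/
def readTape (u : List Bool) (i : ℕ) : TapeSym :=
  match i with
  | 0 => .left
  | k + 1 => match u[k]? with
    | some b => .bit b
    | none => .right

/-- Head moves. -/
inductive Move : Type
  | left : Move
  | stay : Move
  | right : Move

/-- The new position of a head. On the left, no head leaves cell `0`. -/
def Move.apply (i : ℕ) : Move → ℕ
  | .left => i - 1
  | .stay => i
  | .right => i + 1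

/-- Nondeterministic Turing machines with a read-only input tape, a read-only advice tape and
a read-write work tape. -/
structure NTM : Type 1 where
  /-- states -/
  Q : Type
  /-- work tape alphabet -/
  Γ : Type
  finQ : Finite Q
  finΓ : Finite Γ
  start : Q
  accept : Q
  blank : Γ
  /-- possible actions, given the state and the symbols scanned on the input, advice and work tapes:
  the new state, the symbol to be written on the work tape, and the moves of the three heads -/
  trans : Q → TapeSym → TapeSym → Γ → Set (Q × Γ × Move × Move × Move)

namespace NTM

/-- Configurations. -/
structure Conf (M : NTM) : Type where
  state : M.Q
  inputPos : ℕ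
  advicePos : ℕ
  workPos : ℕ
  work : ℕ → M.Γ

/-- The initial configuration. -/
def init (M : NTM) : M.Conf where
  state := M.start
  inputPos := 0
  advicePos := 0
  workPos := 0
  work := fun _ => M.blank

/-- One computation step on the input `u` with the advice `w`. The heads on the read-only tapes do
not move beyond the right end markers. -/
def Step (M : NTM) (u w : List Bool) (c d : M.Conf) : Prop :=
  ∃ (γ : M.Γ) (mi ma mw : Move),
    (d.state, γ, mi, ma, mw) ∈
      M.trans c.state (readTape u c.inputPos) (readTape w c.advicePos) (c.work c.workPos) ∧
    d.inputPos = min (mi.apply c.inputPos) (u.length + 1) ∧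
    d.advicePos = min (ma.apply c.advicePos) (w.length + 1) ∧
    d.workPos = mw.apply c.workPos ∧
    d.work = Function.update c.work c.workPos γ

/-- Configurations reachable from the initial one. -/
def Reachable (M : NTM) (u w : List Bool) (c : M.Conf) : Prop :=
  Relation.ReflTransGen (M.Step u w) M.init c

/-- Some computation reaches the accepting state. -/
def Accepts (M : NTM) (u w : List Bool) : Prop :=
  ∃ c : M.Conf, M.Reachable u w c ∧ c.state = M.accept

/-- Every computation visits only the first `s` cells of the work tape. -/
def UsesSpace (M : NTM) (u w : List Bool) (s : ℕ) : Prop :=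
  ∀ c : M.Conf, M.Reachable u w c → c.workPos < s

end NTM

/-- `NL/poly`: families of Boolean functions computed by nondeterministic Turing machines that
use logarithmic space and are given advice of polynomial length depending only on the length of
the input. -/
def NLpoly : Set BoolFamily :=
  {f | ∃ (M : NTM) (advice : ℕ → List Bool) (P : Polynomial ℕ) (c : ℕ), ∀ n,
    (advice n).length ≤ P.eval n ∧ ∀ x : Fin n → Bool,
      M.UsesSpace (List.ofFn x) (advice n) (c * (Nat.log 2 n + 1)) ∧
      (M.Accepts (List.ofFn x) (advice n) ↔ f n x = true)}

end OBDA

namespace OBDA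

/-! ### Polynomial bounds -/

/-! Graph reachability is the common core of NL/poly and of query answering over ontologies of depth
1.

Rewritings yield formulas. A machine accepts iff a target is reachable in its configuration graph.
That graph has polynomial size, and each edge depends on one scanned input symbol, so it is labelled
by a literal. Non-reachability of `t` from `s` is encoded as a CQ (`certainAnswer_reachCQ_iff`): the
data has one individual whose loops name the false literals, and the ontology adds one null joined
to it in both directions. A match sends `s` to the individual and `t` to the null, and the query
atoms force the individual to spread along true edges; so a match exists iff `t` is unreachable.
Over a one-element structure quantifiers and equality are trivial, so an FO-rewriting collapses to a
Boolean formula of linear size (`collapse_eval`), whose negation expresses reachability.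

Formulas yield rewritings. In depth 1 the canonical model of complete data is the data with nulls
attached to single individuals, and no binary atom joins two nulls (`isModel_canonModel`,
`null_null_not_mem`). Fix for every query variable its root, the individual it equals or hangs from.
It remains to choose which variables become nulls, and the conditions on this choice are clauses
with at most two literals (`exists_match_iff_clauses`). By the 2-SAT criterion
(`exists_assignment_iff`) a choice exists iff no literal and its complement reach each other in the
implication graph. The edges of this graph have short FO definitions; substituting them into a
Boolean formula for reachability and quantifying the roots existentially gives the rewriting
(`exists_rewriting`). The reachability formula is obtained from one fixed family in NL/poly,
computed by a machine whose advice head serves as a counter (`run_reachProgram`,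
`counterNTM_accepts_iff`, `exists_reach_formula`).

Polynomial-size formulas and NC¹ coincide by unfolding circuits in one direction and Brent–Spira
balancing in the other (`NC1_eq_PolyFormula`). -/

theorem polynomial_eval_mono (P : Polynomial ℕ) {m n : ℕ} (h : m ≤ n) : P.eval m ≤ P.eval n := by
  rw [Polynomial.eval_eq_sum_range, Polynomial.eval_eq_sum_range]
  gcongr

theorem exists_polynomial_eval_le_two_pow (P : Polynomial ℕ) :
    ∃ c : ℕ, ∀ n, P.eval n ≤ 2 ^ (c * (Nat.log 2 n + 1)) := by
  induction P using Polynomial.induction_on' with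
  | add p q hp hq =>
    obtain ⟨a, ha⟩ := hp
    obtain ⟨b, hb⟩ := hq
    refine ⟨a + b + 1, fun n => ?_⟩
    have h1 : 2 ^ (a * (Nat.log 2 n + 1)) ≤ 2 ^ ((a + b) * (Nat.log 2 n + 1)) := by
      gcongr <;> omega
    have h2 : 2 ^ (b * (Nat.log 2 n + 1)) ≤ 2 ^ ((a + b) * (Nat.log 2 n + 1)) := by
      gcongr <;> omega
    have h3 : 2 ^ ((a + b) * (Nat.log 2 n + 1) + 1) ≤ 2 ^ ((a + b + 1) * (Nat.log 2 n + 1)) := by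
      apply Nat.pow_le_pow_right (by norm_num)
      rw [add_mul (a + b)]
      omega
    rw [pow_succ] at h3
    rw [Polynomial.eval_add]
    linarith [ha n, hb n]
  | monomial k a =>
    refine ⟨a + k, fun n => ?_⟩
    rw [Polynomial.eval_monomial, add_mul, pow_add]
    apply Nat.mul_le_mul
    · calc a ≤ 2 ^ a := Nat.lt_two_pow_self.le
        _ ≤ _ := Nat.pow_le_pow_right (by norm_num) (Nat.le_mul_of_pos_right _ (by omega))
    · rw [mul_comm, pow_mul]
      exact Nat.pow_le_pow_left (Nat.lt_pow_succ_log_self (by norm_num) n).le k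

theorem exists_two_pow_le_polynomial_eval (c : ℕ) :
    ∃ P : Polynomial ℕ, ∀ n, 2 ^ (c * (Nat.log 2 n + 1)) ≤ P.eval n := by
  refine ⟨(2 * Polynomial.X + 2) ^ c, fun n => ?_⟩
  have h : 2 ^ (Nat.log 2 n + 1) ≤ 2 * n + 2 := by
    rcases Nat.eq_zero_or_pos n with rfl | hn
    · simp
    · have := Nat.pow_log_le_self 2 hn.ne'
      rw [pow_succ]
      omega
  rw [mul_comm, pow_mul]
  simpa using Nat.pow_le_pow_left h c

/-! ### Formulas and circuits -/

namespace BoolFormula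

/-- The length of the longest path from the root to a leaf. -/
def depth {n : ℕ} : BoolFormula n → ℕ
  | const _ => 0
  | var _ => 0
  | neg φ => φ.depth + 1
  | conj φ ψ => max φ.depth ψ.depth + 1
  | disj φ ψ => max φ.depth ψ.depth + 1

theorem depth_lt_size {n : ℕ} (φ : BoolFormula n) : φ.depth < φ.size := by
  induction φ <;> simp only [depth, size] <;> omega

theorem size_lt_two_pow_depth {n : ℕ} (φ : BoolFormula n) : φ.size < 2 ^ (φ.depth + 1) := by
  induction φ with
  | const | var => simp [depth, size]
  | neg φ ih =>
    have : 1 ≤ 2 ^ (φ.depth + 1) := Nat.one_le_two_pow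
    simp only [depth, size]
    rw [pow_succ]
    omega
  | conj φ ψ h1 h2 | disj φ ψ h1 h2 =>
    have a : 2 ^ (φ.depth + 1) ≤ 2 ^ (max φ.depth ψ.depth + 1) :=
      Nat.pow_le_pow_right (by norm_num) (by omega)
    have b : 2 ^ (ψ.depth + 1) ≤ 2 ^ (max φ.depth ψ.depth + 1) :=
      Nat.pow_le_pow_right (by norm_num) (by omega)
    simp only [depth, size]
    rw [pow_succ _ (max φ.depth ψ.depth + 1)]
    omega

/-- A formula with more than `k` symbols has a subformula `ψ` with more than `k` and at most `2k+1`
symbols; `χ b` is the result of replacing `ψ` by `b`. -/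
theorem exists_split {n : ℕ} (k : ℕ) (φ : BoolFormula n) (hk : k < φ.size) :
    ∃ (ψ : BoolFormula n) (χ : Bool → BoolFormula n), k < ψ.size ∧ ψ.size ≤ 2 * k + 1 ∧
      (∀ b, (χ b).size + ψ.size ≤ φ.size + 1) ∧ ∀ x, φ.eval x = (χ (ψ.eval x)).eval x := by
  -- The search descends into a child with more than `k` symbols as long as there is one. Where it
  -- stops, the at most two children have at most `k` symbols each, which gives `2 * k + 1`; there
  -- the whole formula is taken as `ψ`.
  have triv : φ.size ≤ 2 * k + 1 → ∃ (ψ : BoolFormula n) (χ : Bool → BoolFormula n),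
      k < ψ.size ∧ ψ.size ≤ 2 * k + 1 ∧
      (∀ b, (χ b).size + ψ.size ≤ φ.size + 1) ∧ ∀ x, φ.eval x = (χ (ψ.eval x)).eval x := fun h =>
    ⟨φ, const, hk, h, fun b => by simp only [size]; omega, fun x => by simp [eval]⟩
  induction φ with
  | const | var => exact triv (by simp only [size]; omega)
  | neg φ ih =>
    by_cases h : k < φ.size
    · obtain ⟨ψ, χ, h1, h2, h3, h4⟩ := ih h (fun h' =>
        ⟨φ, const, h, h', fun b => by simp only [size]; omega, fun x => by simp [eval]⟩)
      exact ⟨ψ, fun b => neg (χ b), h1, h2, fun b => by have := h3 b; simp only [size]; omega,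
        fun x => by simp [eval, ← h4]⟩
    · exact triv (by simp only [size]; omega)
  | conj φ φ' ih ih' =>
    by_cases h : k < φ.size
    · obtain ⟨ψ, χ, h1, h2, h3, h4⟩ := ih h (fun h' =>
        ⟨φ, const, h, h', fun b => by simp only [size]; omega, fun x => by simp [eval]⟩)
      exact ⟨ψ, fun b => conj (χ b) φ', h1, h2,
        fun b => by have := h3 b; simp only [size]; omega, fun x => by simp [eval, ← h4]⟩
    by_cases h' : k < φ'.size
    · obtain ⟨ψ, χ, h1, h2, h3, h4⟩ := ih' h' (fun h'' =>
        ⟨φ', const, h', h'', fun b => by simp only [size]; omega, fun x => by simp [eval]⟩)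
      exact ⟨ψ, fun b => conj φ (χ b), h1, h2,
        fun b => by have := h3 b; simp only [size]; omega, fun x => by simp [eval, ← h4]⟩
    · exact triv (by simp only [size]; omega)
  | disj φ φ' ih ih' =>
    by_cases h : k < φ.size
    · obtain ⟨ψ, χ, h1, h2, h3, h4⟩ := ih h (fun h' =>
        ⟨φ, const, h, h', fun b => by simp only [size]; omega, fun x => by simp [eval]⟩)
      exact ⟨ψ, fun b => disj (χ b) φ', h1, h2,
        fun b => by have := h3 b; simp only [size]; omega, fun x => by simp [eval, ← h4]⟩
    by_cases h' : k < φ'.size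
    · obtain ⟨ψ, χ, h1, h2, h3, h4⟩ := ih' h' (fun h'' =>
        ⟨φ', const, h', h'', fun b => by simp only [size]; omega, fun x => by simp [eval]⟩)
      exact ⟨ψ, fun b => disj φ (χ b), h1, h2,
        fun b => by have := h3 b; simp only [size]; omega, fun x => by simp [eval, ← h4]⟩
    · exact triv (by simp only [size]; omega)

/-- The hypothesis means that the size is at most 3 + (3/2)^j. Splitting at a third of the size
leaves parts of at most 2/3 of the size plus 1; the fixed point of this map is 3, so the excess over
3 shrinks by the factor 2/3 per round. Selecting between the two contexts by the value of `ψ` adds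
depth 3. -/
theorem exists_balanced {n : ℕ} (j : ℕ) (φ : BoolFormula n)
    (h : φ.size * 2 ^ j ≤ 3 * 2 ^ j + 3 ^ j) :
    ∃ φ' : BoolFormula n, φ'.depth ≤ 3 * j + 3 ∧ ∀ x, φ'.eval x = φ.eval x := by
  induction j generalizing φ with
  | zero => exact ⟨φ, by have := φ.depth_lt_size; omega, fun _ => rfl⟩
  | succ j ih =>
    by_cases h3 : φ.size ≤ 3
    · exact ⟨φ, by have := φ.depth_lt_size; omega, fun _ => rfl⟩
    obtain ⟨ψ, χ, h1, h2, h4, h5⟩ := exists_split (φ.size / 3) φ (by omega)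
    have key : ∀ s, 3 * s ≤ 2 * φ.size + 3 → s * 2 ^ j ≤ 3 * 2 ^ j + 3 ^ j := by
      intro s hs
      have : 3 * s * 2 ^ j ≤ (2 * φ.size + 3) * 2 ^ j := Nat.mul_le_mul_right _ hs
      rw [pow_succ, pow_succ] at h
      nlinarith
    obtain ⟨ψ', d1, e1⟩ := ih ψ (key _ (by omega))
    obtain ⟨χ1, d2, e2⟩ := ih (χ true) (key _ (by have := h4 true; omega))
    obtain ⟨χ0, d3, e3⟩ := ih (χ false) (key _ (by have := h4 false; omega))
    refine ⟨disj (conj ψ' χ1) (conj (neg ψ') χ0), ?_, fun x => ?_⟩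
    · simp only [depth]
      omega
    · simp only [eval, e1, e2, e3, h5 x]
      cases ψ.eval x <;> simp

theorem exists_log_depth {n : ℕ} (φ : BoolFormula n) (L : ℕ) (h : φ.size ≤ 2 ^ L) :
    ∃ φ' : BoolFormula n, φ'.depth ≤ 6 * L + 3 ∧ ∀ x, φ'.eval x = φ.eval x := by
  -- `2 * L` rounds suffice because (3/2)^(2L) = (9/4)^L ≥ 2^L.
  obtain ⟨φ', h1, h2⟩ := exists_balanced (2 * L) φ (by
    have h4 : φ.size * 4 ^ L ≤ 2 ^ L * 4 ^ L := Nat.mul_le_mul_right _ h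
    have h9 : (2 * 4) ^ L ≤ 9 ^ L := Nat.pow_le_pow_left (by norm_num) L
    rw [mul_pow] at h9
    rw [pow_mul, pow_mul]
    norm_num
    omega)
  exact ⟨φ', by omega, h2⟩

end BoolFormula

namespace Gate

/-- The value of a gate, given the values of its possible arguments. -/
def eval {n i : ℕ} (x : Fin n → Bool) (v : Fin i → Bool) : Gate n i → Bool
  | .const b => b
  | .input k => x k
  | .not j => !(v j)
  | .and j k => v j && v k
  | .or j k => v j || v k

/-- The depth of a gate, given the depths of its possible arguments. -/
def depth {n i : ℕ} (d : Fin i → ℕ) : Gate n i → ℕ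
  | .const _ => 0
  | .input _ => 0
  | .not j => d j + 1
  | .and j k => max (d j) (d k) + 1
  | .or j k => max (d j) (d k) + 1

/-- Renaming the arguments of a gate. -/
def map {n i j : ℕ} (f : Fin i → Fin j) : Gate n i → Gate n j
  | .const b => .const b
  | .input k => .input k
  | .not a => .not (f a)
  | .and a b => .and (f a) (f b)
  | .or a b => .or (f a) (f b)

theorem eval_map {n i j : ℕ} (x : Fin n → Bool) (f : Fin i → Fin j) (v : Fin j → Bool)
    (g : Gate n i) : (g.map f).eval x v = g.eval x (v ∘ f) := by
  cases g <;> rfl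

theorem depth_map {n i j : ℕ} (f : Fin i → Fin j) (d : Fin j → ℕ)
    (g : Gate n i) : (g.map f).depth d = g.depth (d ∘ f) := by
  cases g <;> rfl

end Gate

namespace Circuit

theorem val_eq {n : ℕ} (C : Circuit n) (x : Fin n → Bool) (i : Fin C.size) :
    C.val x i = (C.gate i).eval x fun j => C.val x ⟨j, j.isLt.trans i.isLt⟩ := by
  rw [val]
  cases C.gate i <;> rfl

theorem nodeDepth_eq {n : ℕ} (C : Circuit n) (i : Fin C.size) :
    C.nodeDepth i = (C.gate i).depth fun j => C.nodeDepth ⟨j, j.isLt.trans i.isLt⟩ := by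
  rw [nodeDepth]
  cases C.gate i <;> rfl

/-- Unfolding the circuit into a tree preserves depth. The size may grow exponentially in the depth,
which is harmless when the depth is logarithmic. -/
theorem exists_formula_of_node {n : ℕ} (C : Circuit n) (i : Fin C.size) :
    ∃ φ : BoolFormula n, φ.depth = C.nodeDepth i ∧ ∀ x, φ.eval x = C.val x i := by
  obtain ⟨i, hi⟩ := i
  induction i using Nat.strong_induction_on with
  | _ i ih =>
    have ih' : ∀ j : Fin i, ∃ φ : BoolFormula n, φ.depth = C.nodeDepth ⟨j, j.isLt.trans hi⟩ ∧
        ∀ x, φ.eval x = C.val x ⟨j, j.isLt.trans hi⟩ := fun j => ih j j.isLt _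
    choose F hF1 hF2 using ih'
    simp only [val_eq C _ ⟨i, hi⟩, nodeDepth_eq C ⟨i, hi⟩]
    cases C.gate ⟨i, hi⟩ with
    | const b => exact ⟨.const b, rfl, fun _ => rfl⟩
    | input k => exact ⟨.var k, rfl, fun _ => rfl⟩
    | not j => exact ⟨.neg (F j), by simp [BoolFormula.depth, Gate.depth, hF1],
        fun x => by simp [BoolFormula.eval, Gate.eval, hF2]⟩
    | and j k => exact ⟨.conj (F j) (F k), by simp [BoolFormula.depth, Gate.depth, hF1],
        fun x => by simp [BoolFormula.eval, Gate.eval, hF2]⟩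
    | or j k => exact ⟨.disj (F j) (F k), by simp [BoolFormula.depth, Gate.depth, hF1],
        fun x => by simp [BoolFormula.eval, Gate.eval, hF2]⟩

/-- The nodes of two circuits followed by one more gate, which is the output. -/
def join {n : ℕ} (C D : Circuit n) (g : Gate n (C.size + D.size)) : Circuit n where
  size := C.size + D.size + 1
  gate i :=
    if h : i.val < C.size then C.gate ⟨i, h⟩
    else if h' : i.val - C.size < D.size then
      (D.gate ⟨i.val - C.size, h'⟩).map fun j => ⟨C.size + j, by
        have : j.val < i.val - C.size := j.isLt
        omega⟩
    else g.map fun j => ⟨j, by omega⟩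
  output := Fin.last _

/-- A node of the first circuit as a node of the join. -/
def joinLeft {n : ℕ} {C D : Circuit n} (g : Gate n (C.size + D.size)) (i : Fin C.size) :
    Fin (C.join D g).size := ⟨i, by simp only [join]; omega⟩

/-- A node of the second circuit as a node of the join. -/
def joinRight {n : ℕ} {C D : Circuit n} (g : Gate n (C.size + D.size)) (i : Fin D.size) :
    Fin (C.join D g).size := ⟨C.size + i, by simp only [join]; omega⟩

theorem join_left {n : ℕ} (C D : Circuit n) (g : Gate n (C.size + D.size)) (x : Fin n → Bool)
    (i : Fin C.size) : (C.join D g).val x (joinLeft g i) = C.val x i ∧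
      (C.join D g).nodeDepth (joinLeft g i) = C.nodeDepth i := by
  obtain ⟨i, hi⟩ := i
  induction i using Nat.strong_induction_on with
  | _ i ih =>
    have hg : (C.join D g).gate (joinLeft g ⟨i, hi⟩) = C.gate ⟨i, hi⟩ := by
      simp [join, joinLeft, hi]
    rw [val_eq, nodeDepth_eq, hg, val_eq, nodeDepth_eq]
    refine ⟨congrArg (fun v => Gate.eval x v _) ?_, congrArg (fun v => Gate.depth v _) ?_⟩
    · funext j
      exact (ih j j.isLt _).1
    · funext j
      exact (ih j j.isLt _).2

theorem join_right {n : ℕ} (C D : Circuit n) (g : Gate n (C.size + D.size)) (x : Fin n → Bool)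
    (i : Fin D.size) : (C.join D g).val x (joinRight g i) = D.val x i ∧
      (C.join D g).nodeDepth (joinRight g i) = D.nodeDepth i := by
  obtain ⟨i, hi⟩ := i
  induction i using Nat.strong_induction_on with
  | _ i ih =>
    have hg : (C.join D g).gate (joinRight g ⟨i, hi⟩) =
        (D.gate ⟨i, hi⟩).map fun j => ⟨C.size + j, Nat.add_lt_add_left j.isLt _⟩ := by
      -- The gate type depends on the node number, and `C.size + i - C.size` equals `i` only
      -- propositionally; the equality is therefore generalized before substitution.
      have e : ∀ k (hk : k < D.size), k = i → ∀ (f : Fin k → Fin (C.size + i)),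
          (∀ j, (f j).val = C.size + j.val) → (D.gate ⟨k, hk⟩).map f =
          (D.gate ⟨i, hi⟩).map fun j => ⟨C.size + j, Nat.add_lt_add_left j.isLt _⟩ := by
        rintro k hk rfl f hf
        congr 1
        funext j
        exact Fin.ext (hf j)
      simp only [join, joinRight]
      rw [dif_neg (by omega), dif_pos (by omega)]
      exact e _ _ (by omega) _ fun _ => rfl
    rw [val_eq, nodeDepth_eq, hg, val_eq, nodeDepth_eq]
    refine ⟨(Gate.eval_map ..).trans (congrArg (fun v => Gate.eval x v _) ?_),
      (Gate.depth_map ..).trans (congrArg (fun v => Gate.depth v _) ?_)⟩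
    · funext j
      exact (ih j j.isLt _).1
    · funext j
      exact (ih j j.isLt _).2

theorem join_output {n : ℕ} (C D : Circuit n) (g : Gate n (C.size + D.size)) (x : Fin n → Bool) :
    (C.join D g).eval x = g.eval x (fun j => (C.join D g).val x j.castSucc) ∧
      (C.join D g).depth = g.depth (fun j => (C.join D g).nodeDepth j.castSucc) := by
  have hg : (C.join D g).gate (C.join D g).output = g.map fun j => ⟨j, by simp [join]⟩ := by
    simp only [join]
    rw [dif_neg (by simp), dif_neg (by simp)]
  rw [eval, depth, val_eq, nodeDepth_eq, hg, Gate.eval_map, Gate.depth_map]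
  exact ⟨rfl, rfl⟩

theorem exists_of_formula {n : ℕ} (φ : BoolFormula n) :
    ∃ C : Circuit n, C.size ≤ 2 * φ.size ∧ C.depth = φ.depth ∧ ∀ x, C.eval x = φ.eval x := by
  induction φ with
  | const b =>
    refine ⟨⟨1, fun _ => .const b, 0⟩, by simp [BoolFormula.size], ?_, fun x => ?_⟩
    · rw [depth, nodeDepth_eq]; rfl
    · rw [eval, val_eq]; rfl
  | var k =>
    refine ⟨⟨1, fun _ => .input k, 0⟩, by simp [BoolFormula.size], ?_, fun x => ?_⟩
    · rw [depth, nodeDepth_eq]; rfl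
    · rw [eval, val_eq]; rfl
  | neg φ ih =>
    obtain ⟨C, h1, h2, h3⟩ := ih
    -- A dummy circuit fills the second place of `join`; the negation gate reads only the output of
    -- `C`.
    let D : Circuit n := ⟨1, fun _ => .const true, 0⟩
    let g : Gate n (C.size + D.size) := .not (Fin.castAdd _ C.output)
    refine ⟨C.join D g, ?_, ?_, fun x => ?_⟩
    · simp only [join, BoolFormula.size, D]; omega
    · rw [(join_output C D g fun _ => true).2, BoolFormula.depth, ← h2]
      exact congrArg (· + 1) (join_left C D g (fun _ => true) C.output).2
    · rw [(join_output C D g x).1, BoolFormula.eval, ← h3]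
      exact congrArg (! ·) (join_left C D g x C.output).1
  | conj φ ψ ih ih' =>
    obtain ⟨C, h1, h2, h3⟩ := ih
    obtain ⟨D, h1', h2', h3'⟩ := ih'
    let g : Gate n (C.size + D.size) := .and (Fin.castAdd _ C.output) (Fin.natAdd _ D.output)
    refine ⟨C.join D g, ?_, ?_, fun x => ?_⟩
    · simp only [join, BoolFormula.size]; omega
    · rw [(join_output C D g fun _ => true).2, BoolFormula.depth, ← h2, ← h2']
      exact congrArg₂ (max · · + 1) (join_left C D g (fun _ => true) C.output).2
        (join_right C D g (fun _ => true) D.output).2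
    · rw [(join_output C D g x).1, BoolFormula.eval, ← h3, ← h3']
      exact congrArg₂ (· && ·) (join_left C D g x C.output).1 (join_right C D g x D.output).1
  | disj φ ψ ih ih' =>
    obtain ⟨C, h1, h2, h3⟩ := ih
    obtain ⟨D, h1', h2', h3'⟩ := ih'
    let g : Gate n (C.size + D.size) := .or (Fin.castAdd _ C.output) (Fin.natAdd _ D.output)
    refine ⟨C.join D g, ?_, ?_, fun x => ?_⟩
    · simp only [join, BoolFormula.size]; omega
    · rw [(join_output C D g fun _ => true).2, BoolFormula.depth, ← h2, ← h2']
      exact congrArg₂ (max · · + 1) (join_left C D g (fun _ => true) C.output).2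
        (join_right C D g (fun _ => true) D.output).2
    · rw [(join_output C D g x).1, BoolFormula.eval, ← h3, ← h3']
      exact congrArg₂ (· || ·) (join_left C D g x C.output).1 (join_right C D g x D.output).1

end Circuit

theorem NC1_eq_PolyFormula : NC1 = PolyFormula := by
  ext f
  constructor
  · rintro ⟨P, c, h⟩
    obtain ⟨Q, hQ⟩ := exists_two_pow_le_polynomial_eval (c + 1)
    refine ⟨Q, fun n => ?_⟩
    obtain ⟨C, -, h2, h3⟩ := h n
    obtain ⟨φ, h4, h5⟩ := C.exists_formula_of_node C.output
    refine ⟨φ, ?_, fun x => (h5 x).trans (h3 x)⟩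
    refine φ.size_lt_two_pow_depth.le.trans (le_trans ?_ (hQ n))
    apply Nat.pow_le_pow_right (by norm_num)
    have : φ.depth ≤ c * (Nat.log 2 n + 1) := h4.le.trans h2
    rw [add_mul]
    omega
  · rintro ⟨P, h⟩
    obtain ⟨c, hc⟩ := exists_polynomial_eval_le_two_pow P
    obtain ⟨Q, hQ⟩ := exists_two_pow_le_polynomial_eval (6 * c + 4)
    refine ⟨2 * Q, 6 * c + 3, fun n => ?_⟩
    obtain ⟨φ, h1, h2⟩ := h n
    obtain ⟨φ', h3, h4⟩ := φ.exists_log_depth _ (h1.trans (hc n))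
    obtain ⟨C, h5, h6, h7⟩ := Circuit.exists_of_formula φ'
    have hd : φ'.depth ≤ (6 * c + 3) * (Nat.log 2 n + 1) := by
      rw [add_mul, mul_assoc]
      omega
    refine ⟨C, ?_, h6.le.trans hd, fun x => by rw [h7, h4, h2]⟩
    rw [Polynomial.eval_mul, Polynomial.eval_ofNat]
    refine h5.trans (Nat.mul_le_mul_left _ (φ'.size_lt_two_pow_depth.le.trans (le_trans ?_ (hQ n))))
    apply Nat.pow_le_pow_right (by norm_num)
    rw [show 6 * c + 4 = 6 * c + 3 + 1 by omega, add_mul _ 1]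
    omega

theorem Atom.map_map {U V W : Type} (f : U → V) (g : V → W) (α : Atom U) :
    (α.map f).map g = α.map (g ∘ f) := by
  cases α <;> rfl

theorem Atom.pred_map {V W : Type} (f : V → W) (α : Atom V) : (α.map f).pred = α.pred := by
  cases α <;> rfl

/-! ### Reachability in a graph with edges labelled by literals as a query -/

/-- The literal with number `p`: `false`, `true`, `x₀`, `¬x₀`, `x₁`, `¬x₁`, …. -/
def litVal {n : ℕ} (x : Fin n → Bool) (p : ℕ) : Bool :=
  if p = 0 then false
  else if h : 2 ≤ p ∧ p < 2 * n + 2 then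
    if p % 2 = 0 then x ⟨p / 2 - 1, by omega⟩ else !(x ⟨p / 2 - 1, by omega⟩)
  else true

/-- The negation of the literal with number `p` as a formula. -/
def negLit (n p : ℕ) : BoolFormula n :=
  if p = 0 then .const true
  else if h : 2 ≤ p ∧ p < 2 * n + 2 then
    if p % 2 = 0 then .neg (.var ⟨p / 2 - 1, by omega⟩) else .var ⟨p / 2 - 1, by omega⟩
  else .const false

theorem negLit_size (n p : ℕ) : (negLit n p).size ≤ 2 := by
  unfold negLit
  split_ifs <;> simp [BoolFormula.size]

theorem negLit_eval {n : ℕ} (x : Fin n → Bool) (p : ℕ) : (negLit n p).eval x = !litVal x p := by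
  unfold negLit litVal
  split_ifs <;> simp [BoolFormula.eval]

/-- The tgd saying that every element of `un 0` is connected with an element of `un 1` by all the
`bin p` for `p < N` and their inverses. -/
def starTgd (N : ℕ) : Tgd :=
  ⟨.un 0 0, .un 1 1 :: (List.range N).flatMap fun p => [.bin p 0 1, .bin p 1 0]⟩

theorem starTgd_size (N : ℕ) : (starTgd N).size = 2 * N + 2 := by
  simp only [Tgd.size, starTgd, List.length_cons, List.length_flatMap, List.length_nil]
  simp
  omega

theorem mem_starTgd_head (N : ℕ) (ψ : Atom (Fin 2)) : ψ ∈ (starTgd N).head ↔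
    ψ = .un 1 1 ∨ ∃ p < N, ψ = .bin p 0 1 ∨ ψ = .bin p 1 0 := by
  simp [starTgd]

/-- The ontology with the only tgd `starTgd N`. -/
def starOntology (N : ℕ) : Ontology := {starTgd N}

theorem starOntology_size (N : ℕ) : (starOntology N).size = 2 * N + 2 := by
  simp [starOntology, Ontology.size, starTgd_size]

theorem starOntology_un_preds (N p : ℕ) (h : Sum.inl p ∈ (starOntology N).preds) :
    p = 0 ∨ p = 1 := by
  obtain ⟨τ, hτ, h⟩ := h
  obtain rfl : τ = starTgd N := by simpa [starOntology] using hτ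
  rcases h with h | ⟨ψ, hψ, h⟩
  · left
    simpa [starTgd, Atom.pred] using h
  · right
    rcases (mem_starTgd_head N ψ).1 hψ with rfl | ⟨q, -, rfl | rfl⟩ <;> simp_all [Atom.pred]

/-- The tgds with the body `un p 0` are applicable at the individual `0` with the null `0`. -/
theorem chaseStep_un {T : Ontology} {I : Set (Atom (ℕ ⊕ ℕ))} {p : ℕ} {head : List (Atom (Fin 2))}
    (hτ : (⟨.un p 0, head⟩ : Tgd) ∈ T) (hI : Atom.un p (.inl 0) ∈ I) (h0 : Sum.inr 0 ∉ dom I)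
    {ψ : Atom (Fin 2)} (hψ : ψ ∈ head) (hψI : ∀ g, ψ.map g ∉ I) :
    ChaseStep T I (I ∪ {α | ∃ ψ ∈ head, α = ψ.map ![Sum.inl 0, Sum.inr 0]}) := by
  refine ⟨_, hτ, ![Sum.inl 0, Sum.inr 0], hI, ?_, ?_, rfl⟩
  · rintro ⟨g, -, hg⟩
    exact hψI g (hg ψ hψ)
  · intro v hv
    have : v = 1 := by
      simp only [Atom.args, Set.mem_singleton_iff] at hv
      omega
    subst this
    exact ⟨0, rfl, h0⟩

/-- The chase generated by `ϱ` for the ontology `starOntology N`. -/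
def starChase (N : ℕ) (ϱ : Atom (Fin 2)) : Set (Atom (ℕ ⊕ ℕ)) :=
  {.un 2 (.inl 0)} ∪ {ϱ.map ![Sum.inl 0, Sum.inr 0]} ∪
    {α | ϱ = .un 0 0 ∧ ∃ ψ ∈ (starTgd N).head, α = ψ.map ![Sum.inl 0, Sum.inr 0]}

theorem mem_starChase {N : ℕ} {ϱ : Atom (Fin 2)} {α : Atom (ℕ ⊕ ℕ)} : α ∈ starChase N ϱ ↔
    α = .un 2 (.inl 0) ∨ α = ϱ.map ![Sum.inl 0, Sum.inr 0] ∨ ϱ = .un 0 0 ∧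
      (α = .un 1 (.inr 0) ∨
        ∃ p < N, α = .bin p (.inl 0) (.inr 0) ∨ α = .bin p (.inr 0) (.inl 0)) := by
  simp only [starChase, Set.mem_union, Set.mem_singleton_iff, Set.mem_ofPred_eq, or_assoc,
    mem_starTgd_head]
  refine or_congr Iff.rfl (or_congr Iff.rfl (and_congr Iff.rfl ⟨?_, ?_⟩))
  · rintro ⟨ψ, rfl | ⟨p, hp, rfl | rfl⟩, rfl⟩
    · exact Or.inl rfl
    · exact Or.inr ⟨p, hp, Or.inl rfl⟩
    · exact Or.inr ⟨p, hp, Or.inr rfl⟩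
  · rintro (rfl | ⟨p, hp, rfl | rfl⟩)
    · exact ⟨_, Or.inl rfl, rfl⟩
    · exact ⟨_, Or.inr ⟨p, hp, Or.inl rfl⟩, rfl⟩
    · exact ⟨_, Or.inr ⟨p, hp, Or.inr rfl⟩, rfl⟩

theorem starOntology_generators {N : ℕ} {ϱ : Atom (Fin 2)}
    (h : ϱ ∈ (starOntology N).generators) :
    ϱ = .un 0 0 ∨ ϱ = .un 1 0 ∨ ∃ p, ϱ = .bin p 0 0 ∨ ϱ = .bin p 0 1 ∨ ϱ = .bin p 1 0 := by
  obtain ⟨h, p, rfl | rfl | rfl | rfl⟩ := h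
  · rcases starOntology_un_preds N p h with rfl | rfl <;> simp
  all_goals simp

/-- With `un 2` as the fresh predicate, one step produces `ϱ`. The star tgd has the body predicate
`un 0`, which its head never creates, so it fires only if `ϱ` is `un 0 0`, and then once. Thus the
null `0` is the only one ever needed. -/
theorem isGeneratedChase_starChase {N : ℕ} {ϱ : Atom (Fin 2)}
    (h : ϱ ∈ (starOntology N).generators) :
    IsGeneratedChase (starOntology N) ϱ (starChase N ϱ) := by
  have h' := starOntology_generators h
  have hA : Sum.inl 2 ≠ ϱ.pred := by
    rcases h' with rfl | rfl | ⟨p, rfl | rfl | rfl⟩ <;> simp [Atom.pred]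
  refine ⟨2, fun h2 => by simpa using starOntology_un_preds N 2 h2, hA, ?_⟩
  set T' : Ontology := insert ⟨.un 2 0, [ϱ]⟩ (starOntology N)
  have e1 : ∀ α : Atom (ℕ ⊕ ℕ), (∃ ψ ∈ [ϱ], α = ψ.map ![Sum.inl 0, Sum.inr 0]) ↔
    α = ϱ.map ![Sum.inl 0, Sum.inr 0] := by simp
  have step1 : ChaseStep T' {.un 2 (.inl 0)}
      ({.un 2 (.inl 0)} ∪ {ϱ.map ![Sum.inl 0, Sum.inr 0]}) := by
    have := chaseStep_un (T := T') (I := {.un 2 (.inl 0)}) (p := 2) (head := [ϱ])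
      (Finset.mem_insert_self _ _) rfl
      (by simp [dom, Atom.args]) (List.mem_singleton_self ϱ) (fun g hg => hA (by
        rw [← Atom.pred_map g, Set.mem_singleton_iff.1 hg]; rfl))
    simpa only [e1, Set.ofPred_eq_eq_singleton] using this
  have step2 : ({.un 2 (.inl 0)} ∪ {ϱ.map ![Sum.inl 0, Sum.inr 0]} : Set (Atom (ℕ ⊕ ℕ))) =
      starChase N ϱ ∨ ChaseStep T'
      ({.un 2 (.inl 0)} ∪ {ϱ.map ![Sum.inl 0, Sum.inr 0]}) (starChase N ϱ) := by
    by_cases hϱ : ϱ = .un 0 0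
    · right
      subst hϱ
      have := chaseStep_un (T := T') (p := 0)
        (I := {.un 2 (.inl 0)} ∪ {Atom.map ![Sum.inl 0, Sum.inr 0] (.un 0 0)})
        (head := (starTgd N).head)
        (Finset.mem_insert_of_mem (Finset.mem_singleton_self _)) (by right; rfl)
        (by simp [dom, Atom.args, Atom.map]) (ψ := .un 1 1)
        ((mem_starTgd_head N _).2 (Or.inl rfl)) (fun g hg => by simp [Atom.map] at hg)
      simpa [starChase] using this
    · left
      simp [starChase, hϱ]
  have mem1 : ϱ.map ![Sum.inl 0, Sum.inr 0] ∈ starChase N ϱ := by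
    left; right; rfl
  refine ⟨fun k => if k = 0 then {.un 2 (.inl 0)} else if k = 1 then
    {.un 2 (.inl 0)} ∪ {ϱ.map ![Sum.inl 0, Sum.inr 0]} else starChase N ϱ, ?_, ?_, ?_, ?_⟩
  · ext α
    simp [Atom.map]
  · intro k
    rcases k with _ | _ | k
    · exact Or.inr step1
    · exact step2.imp (fun h => h.symm) id
    · exact Or.inl rfl
  · apply subset_antisymm
    · exact fun α hα => Set.mem_iUnion.2 ⟨2, hα⟩
    · refine Set.iUnion_subset fun k => ?_
      rcases k with _ | _ | k
      · exact fun α hα => Or.inl (Or.inl hα)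
      · exact fun α hα => Or.inl hα
      · exact subset_rfl
  · intro τ hτ f hf
    rcases Finset.mem_insert.1 hτ with rfl | hτ
    · have : f 0 = Sum.inl 0 := by
        rcases h' with rfl | rfl | ⟨p, rfl | rfl | rfl⟩ <;>
          simpa [mem_starChase, Atom.map] using hf
      refine ⟨![Sum.inl 0, Sum.inr 0], ?_, fun ψ hψ => ?_⟩
      · simp [Atom.args, this]
      · rw [List.mem_singleton.1 hψ]
        exact mem1
    · obtain rfl : τ = starTgd N := by simpa [starOntology] using hτ
      have : f 0 = Sum.inl 0 ∧ ϱ = .un 0 0 := by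
        rcases h' with rfl | rfl | ⟨p, rfl | rfl | rfl⟩ <;>
          simp [mem_starChase, Atom.map, starTgd] at hf
        exact ⟨hf, rfl⟩
      refine ⟨![Sum.inl 0, Sum.inr 0], ?_, fun ψ hψ => Or.inr ⟨this.2, ψ, hψ, rfl⟩⟩
      simp [Atom.args, this.1, starTgd]

theorem starOntology_isDepthOne {N : ℕ} (hN : 0 < N) : (starOntology N).IsDepthOne := by
  refine ⟨starChase N, fun ϱ h => isGeneratedChase_starChase h, ⟨.un 0 0, ?_, ?_⟩, ?_⟩
  · exact ⟨⟨starTgd N, by simp [starOntology], Or.inl rfl⟩, 0, Or.inl rfl⟩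
  · refine ⟨fun i => if i = 0 then .inl 0 else .inr 0, fun i hi => ⟨⟨0, by simp⟩, 0, Or.inl ?_⟩⟩
    obtain rfl : i = 0 := by omega
    exact Or.inr ⟨rfl, .bin 0 0 1, (mem_starTgd_head N _).2 (Or.inr ⟨0, hN, Or.inl rfl⟩), rfl⟩
  · rintro ϱ h ⟨w, hw⟩
    have key : ∀ R m n, Atom.bin R (.inr m) (.inr n) ∉ starChase N ϱ := by
      intro R m n hmem
      rcases starOntology_generators h with rfl | rfl | ⟨p, rfl | rfl | rfl⟩ <;>
        simp [mem_starChase, Atom.map] at hmem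
    obtain ⟨⟨m, hm⟩, -⟩ := hw 0 (by norm_num)
    obtain ⟨⟨n, hn⟩, R, hR⟩ := hw 1 (by norm_num)
    rw [show 0 + 1 = 1 from rfl] at hm
    rw [hm, hn] at hR
    exact hR.elim (key _ _ _) (key _ _ _)

/-- The data instance with one individual representing a Boolean assignment. -/
def assignmentData {n : ℕ} (x : Fin n → Bool) : Data :=
  insert (.un 0 0) (((Finset.range (2 * n + 2)).filter fun p => litVal x p = false).image
    fun p => .bin p 0 0)

/-- Since literals out of range are true, they give no loops; this lets `mem_assignmentData` drop
the bound on `p`. -/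
theorem litVal_of_le {n : ℕ} (x : Fin n → Bool) {p : ℕ} (h : 2 * n + 2 ≤ p) : litVal x p = true := by
  unfold litVal
  rw [if_neg (by omega), dif_neg (by omega)]

theorem mem_assignmentData {n : ℕ} (x : Fin n → Bool) (α : Atom ℕ) : α ∈ assignmentData x ↔
    α = .un 0 0 ∨ ∃ p, litVal x p = false ∧ α = .bin p 0 0 := by
  simp only [assignmentData, Finset.mem_insert, Finset.mem_image, Finset.mem_filter,
    Finset.mem_range]
  refine or_congr Iff.rfl ⟨fun ⟨p, ⟨_, h⟩, e⟩ => ⟨p, h, e.symm⟩, fun ⟨p, h, e⟩ => ⟨p, ⟨?_, h⟩, e.symm⟩⟩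
  by_contra h'
  simp [litVal_of_le x (not_lt.1 h')] at h

theorem assignmentData_ind {n : ℕ} (x : Fin n → Bool) : (assignmentData x).ind = {0} := by
  ext a
  simp only [Data.ind, dom, Set.mem_ofPred_eq, Finset.mem_coe, mem_assignmentData]
  constructor
  · rintro ⟨α, rfl | ⟨p, -, rfl⟩, ha⟩ <;> simpa [Atom.args] using ha
  · rintro rfl
    exact ⟨_, Or.inl rfl, rfl⟩

/-- The canonical model of `starOntology` and `assignmentData x`: the individual is `false` and the
null is `true`. -/
def starModel {n : ℕ} (x : Fin n → Bool) : Set (Atom Bool) :=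
  {α | α = .un 0 false ∨ α = .un 1 true ∨ ∃ p u v, α = .bin p u v ∧
    (u && v) = false ∧ ((u || v) = false → litVal x p = false)}

theorem isModel_starModel {n : ℕ} (x : Fin n → Bool) :
    IsModel (starOntology (2 * n + 2)) (assignmentData x) (starModel x) (fun _ => false) := by
  constructor
  · intro τ hτ f hf
    obtain rfl : τ = starTgd _ := by simpa [starOntology] using hτ
    have : f 0 = false := by
      simpa [starTgd, starModel, Atom.map] using hf
    refine ⟨![false, true], by simp [starTgd, Atom.args, this], fun ψ hψ => ?_⟩
    rcases (mem_starTgd_head _ ψ).1 hψ with rfl | ⟨q, -, rfl | rfl⟩ <;> simp [starModel, Atom.map]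
  · intro α hα
    rcases (mem_assignmentData x α).1 hα with rfl | ⟨p, hp, rfl⟩
    · simp [starModel, Atom.map]
    · simp [starModel, Atom.map, hp]

/-- Entailed atoms hold in `starModel`, whose atoms over the individual are exactly those of the
data. -/
theorem isComplete_assignmentData {n : ℕ} (x : Fin n → Bool) :
    IsComplete (starOntology (2 * n + 2)) (assignmentData x) := by
  intro α hα h
  have h' := h _ _ _ (isModel_starModel x)
  rw [assignmentData_ind] at hα
  rw [mem_assignmentData]
  cases α with
  | un p a =>
    obtain rfl : a = 0 := by simpa [Atom.args] using hα
    simpa [starModel, Atom.map] using h'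
  | bin p a b =>
    obtain ⟨rfl, rfl⟩ : a = 0 ∧ b = 0 := by simpa [Atom.args, Set.insert_subset_iff] using hα
    simpa [starModel, Atom.map] using h'

/-- The variable for a vertex. -/
def vertexVar {K : ℕ} (u : Fin K) : Fin 0 ⊕ Fin (K + K * K) := .inr (Fin.castAdd _ u)

/-- The variable for an edge. -/
def edgeVar {K : ℕ} (u v : Fin K) : Fin 0 ⊕ Fin (K + K * K) :=
  .inr (Fin.natAdd K (finProdFinEquiv (u, v)))

/-- The atoms of `reachCQ`. -/
def reachAtoms {K : ℕ} (lit : Fin K → Fin K → ℕ) (s t : Fin K) :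
    List (Atom (Fin 0 ⊕ Fin (K + K * K))) :=
  .bin 0 (vertexVar s) (vertexVar s) :: .un 1 (vertexVar t) ::
    (List.finRange K).flatMap fun u => (List.finRange K).flatMap fun v =>
      [.bin (lit u v) (vertexVar u) (edgeVar u v), .bin 0 (edgeVar u v) (vertexVar v)]

theorem mem_reachAtoms {K : ℕ} (lit : Fin K → Fin K → ℕ) (s t : Fin K)
    (α : Atom (Fin 0 ⊕ Fin (K + K * K))) : α ∈ reachAtoms lit s t ↔
    α = .bin 0 (vertexVar s) (vertexVar s) ∨ α = .un 1 (vertexVar t) ∨ ∃ u v,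
      α = .bin (lit u v) (vertexVar u) (edgeVar u v) ∨
      α = .bin 0 (edgeVar u v) (vertexVar v) := by
  simp [reachAtoms]

/-- The query saying that `t` is not reachable from `s` in the graph with the edges labelled by the
literals `lit`. -/
def reachCQ {K : ℕ} (lit : Fin K → Fin K → ℕ) (s t : Fin K) : CQ 0 where
  numEx := K + K * K
  atoms := reachAtoms lit s t

theorem reachCQ_size {K : ℕ} (lit : Fin K → Fin K → ℕ) (s t : Fin K) :
    (reachCQ lit s t).size = 3 * (K * K) + K + 2 := by
  simp only [CQ.size, reachCQ, reachAtoms, List.length_cons, List.length_flatMap, List.length_nil]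
  simp
  ring

theorem reachCQ_holds_iff {K : ℕ} (lit : Fin K → Fin K → ℕ) (s t : Fin K) {D : Type}
    (I : Set (Atom D)) (a : Fin 0 → D) : (reachCQ lit s t).Holds I a ↔
    ∃ (y : Fin K → D) (k : Fin K → Fin K → D), .bin 0 (y s) (y s) ∈ I ∧ .un 1 (y t) ∈ I ∧
      ∀ u v, .bin (lit u v) (y u) (k u v) ∈ I ∧ .bin 0 (k u v) (y v) ∈ I := by
  constructor
  · rintro ⟨b, hb⟩
    have hb' := fun α h => hb α ((mem_reachAtoms lit s t α).2 h)
    exact ⟨fun u => b (Fin.castAdd _ u), fun u v => b (Fin.natAdd K (finProdFinEquiv (u, v))),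
      hb' _ (Or.inl rfl), hb' _ (Or.inr (Or.inl rfl)), fun u v =>
      ⟨hb' _ (Or.inr (Or.inr ⟨u, v, Or.inl rfl⟩)), hb' _ (Or.inr (Or.inr ⟨u, v, Or.inr rfl⟩))⟩⟩
  · rintro ⟨y, k, h1, h2, h3⟩
    have hv : ∀ u : Fin K, Sum.elim a (Fin.addCases y fun e => k (finProdFinEquiv.symm e).1
        (finProdFinEquiv.symm e).2) (vertexVar u) = y u := fun u => by simp [vertexVar]
    have he : ∀ u v : Fin K, Sum.elim a (Fin.addCases y fun e => k (finProdFinEquiv.symm e).1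
        (finProdFinEquiv.symm e).2) (edgeVar u v) = k u v := fun u v => by
      rw [edgeVar, Sum.elim_inr, Fin.addCases_right, Equiv.symm_apply_apply]
    refine ⟨Fin.addCases y fun e => k (finProdFinEquiv.symm e).1 (finProdFinEquiv.symm e).2,
      fun α hα => ?_⟩
    rcases (mem_reachAtoms lit s t α).1 hα with rfl | rfl | ⟨u, v, rfl | rfl⟩
    · exact Eq.mpr (congrArg (· ∈ I) (congrArg₂ (Atom.bin 0) (hv s) (hv s))) h1
    · exact Eq.mpr (congrArg (· ∈ I) (congrArg (Atom.un 1) (hv t))) h2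
    · exact Eq.mpr (congrArg (· ∈ I) (congrArg₂ (Atom.bin _) (hv u) (he u v))) (h3 u v).1
    · exact Eq.mpr (congrArg (· ∈ I) (congrArg₂ (Atom.bin 0) (he u v) (hv v))) (h3 u v).2

/-- In `starModel` no binary atom joins the null to itself, and a loop at the individual requires a
false literal. If `y u` is the individual and the edge literal is true, then `k u v` is the null and
so `y v` is the individual again. This starts at `s`, which has a loop, and contradicts `un 1` at a
reachable `t`. -/
theorem certainAnswer_reachCQ_iff {n K : ℕ} (lit : Fin K → Fin K → ℕ)
    (hlit : ∀ u v, lit u v < 2 * n + 2) (s t : Fin K) (x : Fin n → Bool) (a : Fin 0 → ℕ) :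
    CertainAnswer (starOntology (2 * n + 2)) (assignmentData x) (reachCQ lit s t) a ↔
      ¬ Relation.ReflTransGen (fun u v => litVal x (lit u v) = true) s t := by
  constructor
  · intro h hreach
    obtain ⟨y, k, h1, h2, h3⟩ := (reachCQ_holds_iff ..).1 (h _ _ _ (isModel_starModel x))
    have : y t = false := by
      clear h2 h
      induction hreach with
      | refl => simpa [starModel, litVal] using h1
      | @tail u v _ huv ih =>
        have h4 := (h3 u v).1
        have h5 := (h3 u v).2
        simp only [ih, starModel, Set.mem_ofPred_eq, reduceCtorEq, Atom.bin.injEq, false_or] at h4 h5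
        obtain ⟨p, u', v', ⟨rfl, rfl, rfl⟩, -, h4⟩ := h4
        obtain ⟨p, u', v', ⟨rfl, rfl, rfl⟩, h5, -⟩ := h5
        cases hk : k u v <;> simp_all
    simp [starModel, this] at h2
  · intro h D I c hI
    classical
    have hc : Atom.un 0 (c 0) ∈ I := hI.2 _ ((mem_assignmentData x _).2 (Or.inl rfl))
    have hb : ∀ p, litVal x p = false → Atom.bin p (c 0) (c 0) ∈ I := fun p hp =>
      hI.2 _ ((mem_assignmentData x _).2 (Or.inr ⟨p, hp, rfl⟩))
    obtain ⟨g, hg, hg'⟩ := hI.1 (starTgd _) (Finset.mem_singleton_self _) (fun _ => c 0) hc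
    have hg0 : g 0 = c 0 := hg 0 rfl
    have hw : Atom.un 1 (g 1) ∈ I := hg' (.un 1 1) ((mem_starTgd_head _ _).2 (Or.inl rfl))
    have hl : ∀ p < 2 * n + 2, Atom.bin p (c 0) (g 1) ∈ I := fun p hp => hg0 ▸
      hg' (.bin p 0 1) ((mem_starTgd_head _ _).2 (Or.inr ⟨p, hp, Or.inl rfl⟩))
    have hr : ∀ p < 2 * n + 2, Atom.bin p (g 1) (c 0) ∈ I := fun p hp => hg0 ▸
      hg' (.bin p 1 0) ((mem_starTgd_head _ _).2 (Or.inr ⟨p, hp, Or.inr rfl⟩))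
    have h0 : Atom.bin 0 (c 0) (c 0) ∈ I := hb 0 rfl
    let R := Relation.ReflTransGen (fun u v => litVal x (lit u v) = true) s
    -- Reachable vertices go to the individual, the others to the element `g 1` supplied by the tgd.
    -- The midpoint of an edge has to be `g 1` only when a true edge leaves a reachable vertex, and
    -- then its end is reachable too.
    refine (reachCQ_holds_iff ..).2 ⟨fun u => if R u then c 0 else g 1, fun u v =>
      if R u ∧ litVal x (lit u v) = true then g 1 else c 0, ?_, ?_, fun u v => ?_⟩
    · simpa only [show R s from Relation.ReflTransGen.refl, if_true] using h0
    · simpa only [show ¬ R t from h, if_false] using hw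
    · have hstep : R u → litVal x (lit u v) = true → R v := Relation.ReflTransGen.tail
      by_cases hu : R u <;> by_cases hv : R v <;> cases huv : litVal x (lit u v) <;>
        first
        | exact absurd (hstep hu huv) hv
        | simp [hu, hv, h0, hl _ (hlit u v), hr _ (hlit u v), hl 0 (by omega),
        hr 0 (by omega), hb _, huv]

/-! ### First-order sentences over structures with one element -/

/-- The value of an FO-formula in `assignmentData x` as a Boolean formula. -/
def collapse (n : ℕ) : {k : ℕ} → Voc.BoundedFormula (Fin 0) k → BoolFormula n
  | _, .falsum => .const false
  | _, .equal _ _ => .const true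
  | _, .rel (l := _) R _ =>
    match R with
    | VocRel.un p => .const (p == 0)
    | VocRel.bin p => negLit n p
  | _, .imp φ ψ => .disj (.neg (collapse n φ)) (collapse n ψ)
  | _, .all φ => collapse n φ

theorem collapse_size (n : ℕ) {k : ℕ} (φ : Voc.BoundedFormula (Fin 0) k) :
    (collapse n φ).size ≤ 2 * foSize φ := by
  induction φ with
  | falsum => simp [collapse, BoolFormula.size, foSize]
  | equal => simp [collapse, BoolFormula.size, foSize]
  | rel R ts =>
    cases R with
    | un p => simp [collapse, BoolFormula.size, foSize]
    | bin p =>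
      have := negLit_size n p
      simp only [collapse, foSize]
      omega
  | imp φ ψ h1 h2 => simp only [collapse, BoolFormula.size, foSize]; omega
  | all φ ih => simp only [collapse, foSize]; omega

/-- The domain is a singleton, so only the loops carry information, and the loop `bin p 0 0` is
present iff literal `p` is false; hence `negLit` in `collapse`. -/
theorem collapse_eval {n : ℕ} (x : Fin n → Bool) {k : ℕ} (φ : Voc.BoundedFormula (Fin 0) k)
    (a : Fin 0 → (assignmentData x).ind) (b : Fin k → (assignmentData x).ind) :
    letI : Voc.Structure (assignmentData x).ind :=
      toStructure {α | α.map Subtype.val ∈ assignmentData x}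
    (collapse n φ).eval x = true ↔ φ.Realize a b := by
  have hsub : ∀ i : (assignmentData x).ind, (i : ℕ) = 0 := fun i =>
    (assignmentData_ind x).subset i.2
  let _ : Voc.Structure (assignmentData x).ind :=
    toStructure {α | α.map Subtype.val ∈ assignmentData x}
  induction φ with
  | falsum => simp [collapse, BoolFormula.eval, FirstOrder.Language.BoundedFormula.Realize]
  | equal t₁ t₂ =>
    simp only [collapse, BoolFormula.eval, FirstOrder.Language.BoundedFormula.Realize, true_iff]
    exact Subtype.ext ((hsub _).trans (hsub _).symm)
  | rel R ts =>
    cases R with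
    | un p =>
      simp only [collapse, BoolFormula.eval, FirstOrder.Language.BoundedFormula.Realize,
        FirstOrder.Language.Structure.RelMap, Set.mem_ofPred_eq, mem_assignmentData, Atom.map, hsub]
      simp
    | bin p =>
      simp only [collapse, negLit_eval, FirstOrder.Language.BoundedFormula.Realize,
        FirstOrder.Language.Structure.RelMap, Set.mem_ofPred_eq, mem_assignmentData, Atom.map, hsub]
      simp
  | imp φ ψ h1 h2 =>
    simp only [collapse, BoolFormula.eval, FirstOrder.Language.BoundedFormula.Realize, ← h1, ← h2]
    cases (collapse n φ).eval x <;> simp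
  | all φ ih =>
    simp only [collapse, FirstOrder.Language.BoundedFormula.Realize]
    have h0 : 0 ∈ (assignmentData x).ind := by
      rw [assignmentData_ind]
      rfl
    exact ⟨fun h i => (ih _).1 h, fun h => (ih _).2 (h ⟨0, h0⟩)⟩

theorem exists_formula_of_reach {P : Polynomial ℕ}
    (hP : ∀ (T : Ontology) (m : ℕ) (q : CQ m), T.IsDepthOne →
      ∃ φ : Voc.Formula (Fin m), IsFORewriting T q φ ∧ foSize φ ≤ P.eval (q.size + T.size))
    {n K : ℕ} (lit : Fin K → Fin K → ℕ) (hlit : ∀ u v, lit u v < 2 * n + 2) (s t : Fin K) :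
    ∃ φ : BoolFormula n, φ.size ≤ 2 * P.eval (3 * (K * K) + K + 4 * n + 8) + 1 ∧ ∀ x,
      φ.eval x = true ↔ Relation.ReflTransGen (fun u v => litVal x (lit u v) = true) s t := by
  obtain ⟨φ, h1, h2⟩ := hP (starOntology (2 * n + 2)) 0 (reachCQ lit s t)
    (starOntology_isDepthOne (by omega))
  -- The query expresses non-reachability, hence the negation.
  refine ⟨.neg (collapse n φ), ?_, fun x => ?_⟩
  · rw [reachCQ_size, starOntology_size] at h2
    have h3 := collapse_size n φ
    rw [show 3 * (K * K) + K + 2 + (2 * (2 * n + 2) + 2) = 3 * (K * K) + K + 4 * n + 8 by ring] at h2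
    simp only [BoolFormula.size]
    omega
  · have h3 := (h1 _ (isComplete_assignmentData x) Fin.elim0).symm.trans
      (certainAnswer_reachCQ_iff lit hlit s t x _)
    have h4 := (collapse_eval x φ Fin.elim0 default).trans h3
    simp only [BoolFormula.eval, Bool.not_eq_true', ← Bool.not_eq_true, h4, not_not]

/-! ### Configuration graphs -/

/-- An end marker makes the property constant; otherwise the cell holds one bit, and the four truth
tables of a property of one bit are true, the bit, its negation and false. -/
theorem exists_lit_iff {n : ℕ} (S : TapeSym → Prop) (i : ℕ) : ∃ p < 2 * n + 2,
    ∀ x : Fin n → Bool, S (readTape (List.ofFn x) i) ↔ litVal x p = true := by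
  classical
  have const : ∀ a : Prop, ∃ p < 2 * n + 2, ∀ x : Fin n → Bool, a ↔ litVal x p = true := fun a => by
    by_cases ha : a
    · exact ⟨1, by omega, fun x => by simp [litVal, ha]⟩
    · exact ⟨0, by omega, fun x => by simp [litVal, ha]⟩
  rcases i with _ | k
  · exact const (S .left)
  by_cases hk : k < n
  · have hr : ∀ x : Fin n → Bool, readTape (List.ofFn x) (k + 1) = .bit (x ⟨k, hk⟩) := fun x => by
      simp [readTape, hk]
    have hpos : ∀ x : Fin n → Bool, litVal x (2 * k + 2) = x ⟨k, hk⟩ := fun x => by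
      rw [litVal, if_neg (by omega), dif_pos (by omega), if_pos (by omega)]
      congr 2
      omega
    have hneg : ∀ x : Fin n → Bool, litVal x (2 * k + 3) = !x ⟨k, hk⟩ := fun x => by
      rw [litVal, if_neg (by omega), dif_pos (by omega), if_neg (by omega)]
      congr 3
      omega
    simp only [hr]
    by_cases ht : S (.bit true) <;> by_cases hf : S (.bit false)
    · exact ⟨1, by omega, fun x => by cases x ⟨k, hk⟩ <;> simp [litVal, ht, hf]⟩
    · exact ⟨2 * k + 2, by omega, fun x => by rw [hpos]; cases x ⟨k, hk⟩ <;> simp [ht, hf]⟩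
    · exact ⟨2 * k + 3, by omega, fun x => by rw [hneg]; cases x ⟨k, hk⟩ <;> simp [ht, hf]⟩
    · exact ⟨0, by omega, fun x => by cases x ⟨k, hk⟩ <;> simp [litVal, ht, hf]⟩
  · have hr : ∀ x : Fin n → Bool, readTape (List.ofFn x) (k + 1) = .right := fun x => by
      simp [readTape, hk]
    simp only [hr]
    exact const _

namespace NTM

/-- Configurations with the heads in the first cells of the tapes. -/
abbrev FinConf (M : NTM) (n l s : ℕ) : Type :=
  M.Q × Fin (n + 2) × Fin (l + 2) × Fin s × (Fin s → M.Γ)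

/-- A configuration in which all the cells of the work tape from `s` on are blank. -/
def FinConf.toConf {M : NTM} {n l s : ℕ} (c : M.FinConf n l s) : M.Conf where
  state := c.1
  inputPos := c.2.1
  advicePos := c.2.2.1
  workPos := c.2.2.2.1
  work i := if h : i < s then c.2.2.2.2 ⟨i, h⟩ else M.blank

theorem exists_finConf {M : NTM} {n l s : ℕ} (c : M.Conf) (h1 : c.inputPos < n + 2)
    (h2 : c.advicePos < l + 2) (h3 : c.workPos < s) (h4 : ∀ i, s ≤ i → c.work i = M.blank) :
    ∃ c' : M.FinConf n l s, c'.toConf = c := by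
  refine ⟨⟨c.state, ⟨_, h1⟩, ⟨_, h2⟩, ⟨_, h3⟩, fun i => c.work i⟩, ?_⟩
  obtain ⟨q, i, a, w, f⟩ := c
  simp only [FinConf.toConf, Conf.mk.injEq, true_and]
  funext i
  split_ifs with h
  · rfl
  · exact (h4 i (not_lt.1 h)).symm

/-- The edges of the configuration graph with an additional vertex `none` reachable from the
accepting configurations. -/
def Edge (M : NTM) (u w : List Bool) {n l s : ℕ} :
    Option (M.FinConf n l s) → Option (M.FinConf n l s) → Prop
  | some c, some d => M.Step u w c.toConf d.toConf
  | some c, none => c.1 = M.accept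
  | none, _ => False

/-- The space bound confines reachable configurations to the first `s` work cells. All other cells
stay blank, so a `FinConf` loses no information. -/
theorem accepts_iff_reflTransGen_edge {M : NTM} {u w : List Bool} {n l s : ℕ} (hn : u.length = n)
    (hl : w.length = l) (hs : M.UsesSpace u w s) {c₀ : M.FinConf n l s} (h₀ : c₀.toConf = M.init) :
    M.Accepts u w ↔ Relation.ReflTransGen (M.Edge u w (n := n) (l := l) (s := s))
      (some c₀) none := by
  constructor
  · rintro ⟨c, hc, hacc⟩
    suffices h : ∃ c' : M.FinConf n l s, c'.toConf = c ∧
        Relation.ReflTransGen (M.Edge u w) (some c₀) (some c') by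
      obtain ⟨c', rfl, h⟩ := h
      exact h.tail (show c'.1 = M.accept from hacc)
    clear hacc
    induction hc with
    | refl => exact ⟨c₀, h₀, .refl⟩
    | @tail c d hc hcd ih =>
      obtain ⟨c', rfl, h⟩ := ih
      have hd := hs d (hc.tail hcd)
      have hcd' := hcd
      obtain ⟨γ, mi, ma, mw, -, e1, e2, e3, e4⟩ := hcd'
      obtain ⟨d', rfl⟩ : ∃ d' : M.FinConf n l s, d'.toConf = d := by
        refine exists_finConf d (by omega) (by omega) hd fun i hi => ?_
        have : i ≠ c'.toConf.workPos := by
          have := c'.2.2.2.1.isLt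
          simp only [FinConf.toConf]
          omega
        rw [e4, Function.update_of_ne this]
        simp [FinConf.toConf, not_lt.2 hi]
      exact ⟨d', rfl, h.tail hcd⟩
  · intro h
    have key : ∀ v, Relation.ReflTransGen (M.Edge u w (n := n) (l := l) (s := s)) (some c₀) v →
        (∀ c, v = some c → M.Reachable u w c.toConf) ∧ (v = none → M.Accepts u w) := by
      intro v hv
      induction hv with
      | refl =>
        refine ⟨fun c hc => ?_, by simp⟩
        cases hc
        rw [h₀]
        exact .refl
      | @tail v v' _ hvv ih =>
        cases v with
        | none => exact hvv.elim
        | some c =>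
          refine ⟨?_, ?_⟩
          · rintro d rfl
            exact (ih.1 c rfl).tail hvv
          · rintro rfl
            exact ⟨_, ih.1 c rfl, hvv⟩
    exact (key _ h).2 rfl

/-- For fixed configurations and advice, the input affects a step only through the single scanned
symbol. -/
theorem exists_lit_edge {M : NTM} (w : List Bool) {n l s : ℕ} (c d : Option (M.FinConf n l s)) :
    ∃ p < 2 * n + 2, ∀ x : Fin n → Bool, M.Edge (List.ofFn x) w c d ↔ litVal x p = true := by
  rcases c with _ | c
  · exact exists_lit_iff (fun _ => False) 0
  rcases d with _ | d
  · exact exists_lit_iff (fun _ => c.1 = M.accept) 0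
  simp only [Edge, Step, List.length_ofFn]
  exact exists_lit_iff (fun a => ∃ (γ : M.Γ) (mi ma mw : Move),
    (d.toConf.state, γ, mi, ma, mw) ∈
      M.trans c.toConf.state a (readTape w c.toConf.advicePos) (c.toConf.work c.toConf.workPos) ∧
    d.toConf.inputPos = min (mi.apply c.toConf.inputPos) (n + 1) ∧
    d.toConf.advicePos = min (ma.apply c.toConf.advicePos) (w.length + 1) ∧
    d.toConf.workPos = mw.apply c.toConf.workPos ∧
    d.toConf.work = Function.update c.toConf.work c.toConf.workPos γ) c.toConf.inputPos

end NTM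

theorem NLpoly_subset_PolyFormula_of_rewritings (h : PolySizeFORewritingsDepthOne) :
    NLpoly ⊆ PolyFormula := by
  obtain ⟨P, hP⟩ := h
  rintro f ⟨M, advice, A, c, hM⟩
  have := M.finQ
  have := M.finΓ
  obtain ⟨S, hS⟩ := exists_two_pow_le_polynomial_eval c
  obtain ⟨W, hW⟩ := exists_two_pow_le_polynomial_eval (Nat.card M.Γ * c)
  let B : Polynomial ℕ := (Nat.card M.Q : Polynomial ℕ) * ((.X + 2) * ((A + 2) * (S * W))) + 1
  refine ⟨2 * P.comp (3 * (B * B) + B + 4 * .X + 8) + 1, fun n => ?_⟩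
  obtain ⟨hA, hM⟩ := hM n
  set s := c * (Nat.log 2 n + 1)
  set l := (advice n).length
  -- The initial configuration already occupies cell 0, which forces the space bound to be positive.
  have hs : 0 < s := (hM fun _ => false).1 M.init .refl
  obtain ⟨c₀, hc₀⟩ := NTM.exists_finConf (n := n) (l := l) (s := s) M.init (by simp [NTM.init])
    (by simp [NTM.init]) (by simpa [NTM.init] using hs) (by simp [NTM.init])
  let V := Option (M.FinConf n l s)
  let e : V ≃ Fin (Nat.card V) := Finite.equivFin V
  have hK : Nat.card V ≤ B.eval n := by
    have h1 : Nat.card V = Nat.card M.Q * ((n + 2) * ((l + 2) * (s * Nat.card M.Γ ^ s))) + 1 := by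
      simp only [V, Finite.card_option, Nat.card_prod, Nat.card_fun, Nat.card_fin]
    have h2 : s ≤ S.eval n := Nat.lt_two_pow_self.le.trans (hS n)
    -- The number of work tape contents is polynomial because |Γ| ≤ 2^|Γ| and `s` is logarithmic.
    have h3 : Nat.card M.Γ ^ s ≤ W.eval n := by
      refine le_trans ?_ (hW n)
      rw [mul_assoc, pow_mul 2]
      exact Nat.pow_le_pow_left Nat.lt_two_pow_self.le _
    rw [h1]
    simp only [B, Polynomial.eval_add, Polynomial.eval_mul, Polynomial.eval_X,
      Polynomial.eval_ofNat, Polynomial.eval_one, Polynomial.eval_natCast, Nat.cast_id]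
    gcongr
  choose lit hlit hlit' using fun u v : Fin (Nat.card V) =>
    NTM.exists_lit_edge (advice n) (e.symm u) (e.symm v)
  obtain ⟨φ, h1, h2⟩ := exists_formula_of_reach hP lit hlit (e (some c₀)) (e none)
  refine ⟨φ, h1.trans ?_, fun x => ?_⟩
  · simp only [Polynomial.eval_add, Polynomial.eval_mul, Polynomial.eval_X,
      Polynomial.eval_ofNat, Polynomial.eval_one, Polynomial.eval_comp]
    gcongr
    apply polynomial_eval_mono
    gcongr
  · rw [Bool.eq_iff_iff, h2, ← (hM x).2,
      NTM.accepts_iff_reflTransGen_edge (List.length_ofFn ..) rfl (hM x).1 hc₀]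
    simp only [← hlit']
    constructor
    · intro h
      have := h.lift (p := M.Edge (List.ofFn x) (advice n)) e.symm fun _ _ => id
      simpa [Function.onFun] using this
    · intro h
      exact h.lift e fun a b hab => by simpa [Function.onFun] using hab

/-! ### Paths of bounded length -/

/-- There is a path of length at most `j` from `k` to `t`. -/
def Within (R : ℕ → ℕ → Prop) (t : ℕ) : ℕ → ℕ → Prop
  | 0, k => k = t
  | j + 1, k => Within R t j k ∨ ∃ k', R k k' ∧ Within R t j k'

theorem Within.mono {R : ℕ → ℕ → Prop} {t i j k : ℕ} (h : i ≤ j) (hk : Within R t i k) :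
    Within R t j k := by
  induction h with
  | refl => exact hk
  | step _ ih => exact Or.inl ih

/-- The sets `S j` of vertices below `N` at distance at most `j` from `t` increase. Either they
stabilize before `N`, and then contain every vertex that reaches `t`, or they gain an element each
time and exceed `N` elements. -/
theorem within_of_reflTransGen {R : ℕ → ℕ → Prop} {N s t : ℕ} (hR : ∀ u v, R u v → u < N)
    (ht : t < N) (h : Relation.ReflTransGen R s t) : Within R t N s := by
  classical
  let S : ℕ → Finset ℕ := fun j => (Finset.range N).filter (Within R t j)
  have hS : ∀ j, S j ⊆ S (j + 1) := fun j k hk => by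
    simp only [S, Finset.mem_filter] at hk ⊢
    exact ⟨hk.1, Or.inl hk.2⟩
  have key : ∀ j, (∃ i < j, S (i + 1) ⊆ S i) ∨ j < (S j).card := by
    intro j
    induction j with
    | zero => exact Or.inr (Finset.card_pos.2 ⟨t, Finset.mem_filter.2 ⟨Finset.mem_range.2 ht, rfl⟩⟩)
    | succ j ih =>
      rcases ih with ⟨i, hi, h⟩ | ih
      · exact Or.inl ⟨i, by omega, h⟩
      · by_cases h : S (j + 1) ⊆ S j
        · exact Or.inl ⟨j, by omega, h⟩
        · have := Finset.card_lt_card (Finset.ssubset_iff_subset_ne.2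
            ⟨hS j, fun e => h e.symm.subset⟩)
          exact Or.inr (by omega)
  rcases key N with ⟨i, hi, hst⟩ | hN
  · suffices h' : Within R t i s from h'.mono hi.le
    induction h using Relation.ReflTransGen.head_induction_on with
    | refl => exact Within.mono (Nat.zero_le i) rfl
    | @head u v huv _ ih =>
      exact (Finset.mem_filter.1 (hst (Finset.mem_filter.2
        ⟨Finset.mem_range.2 (hR u v huv), Or.inr ⟨v, huv, ih⟩⟩))).2
  · have : (S N).card ≤ N := (Finset.card_filter_le _ _).trans (Finset.card_range N).le
    omega

/-! ### Nondeterministic counter programs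

A command is a pair of bits: `(false, false)` decrements the counter, `(false, true)` tests it for
zero, `(true, false)` increments it, and `(true, true)` starts a block of commands, which can be
executed or skipped. -/

/-- The program can be run successfully starting with the counter value `k`; the commands up to the
next `(true, true)` are executed if the first argument is `true`, and skipped otherwise. -/
def Run : Bool → ℕ → List (Bool × Bool) → Prop
  | m, k, [] => m = true ∧ k = 0
  | m, k, (b, c) :: r =>
    match b, c, m with
    | true, true, _ => Run true k r ∨ Run false k r
    | _, _, false => Run false k r
    | true, false, true => Run true (k + 1) r
    | false, false, true => 0 < k ∧ Run true (k - 1) r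
    | false, true, true => k = 0 ∧ Run true k r

theorem run_delim (m : Bool) (k : ℕ) (r : List (Bool × Bool)) :
    Run m k ((true, true) :: r) ↔ Run true k r ∨ Run false k r := by
  cases m <;> rfl

theorem run_skip (k : ℕ) (l r : List (Bool × Bool)) (h : (true, true) ∉ l) :
    Run false k (l ++ r) ↔ Run false k r := by
  induction l with
  | nil => rfl
  | cons p l ih =>
    obtain ⟨h1, h2⟩ := List.ne_and_not_mem_of_not_mem_cons h
    obtain ⟨_ | _, _ | _⟩ := p
    · exact ih h2
    · exact ih h2
    · exact ih h2
    · simp at h1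

theorem run_dec (a k : ℕ) (r : List (Bool × Bool)) :
    Run true k (List.replicate a (false, false) ++ r) ↔ a ≤ k ∧ Run true (k - a) r := by
  induction a generalizing k with
  | zero => simp
  | succ a ih =>
    refine (and_congr Iff.rfl (ih (k - 1))).trans ?_
    rw [← and_assoc, Nat.sub_sub, Nat.add_comm 1 a]
    exact and_congr (by omega) Iff.rfl

theorem run_inc (a k : ℕ) (r : List (Bool × Bool)) :
    Run true k (List.replicate a (true, false) ++ r) ↔ Run true (k + a) r := by
  induction a generalizing k with
  | zero => simp
  | succ a ih =>
    refine (ih (k + 1)).trans ?_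
    rw [Nat.add_assoc, Nat.add_comm 1 a]

/-- The block of commands for an edge from `e.1` to `e.2`, which is present if `x`. -/
def edgeBlock (e : ℕ × ℕ) (x : Bool) : List (Bool × Bool) :=
  (true, true) :: (List.replicate e.1 (false, false) ++ (false, true) :: (false, x) ::
    List.replicate e.2 (true, false))

/-- Decrementing `e.1` times and then testing for zero succeeds iff the counter was `e.1`. At
counter 0 the command `(false, x)` is a passing zero test if `x` is true and a failing decrement if
`x` is false, so the edge bit acts as a guard. -/
theorem run_edgeBlock (m : Bool) (k : ℕ) (e : ℕ × ℕ) (x : Bool) (r : List (Bool × Bool)) :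
    Run m k (edgeBlock e x ++ r) ↔ (x = true ∧ k = e.1 ∧ Run true e.2 r) ∨ Run false k r := by
  rw [edgeBlock, List.cons_append, run_delim, run_skip]
  · refine or_congr ?_ Iff.rfl
    rw [List.append_assoc, run_dec]
    change _ ∧ k - e.1 = 0 ∧ Run true (k - e.1) ((false, x) :: (List.replicate e.2 _ ++ r)) ↔ _
    constructor
    · rintro ⟨h1, h2, h3⟩
      obtain rfl : k = e.1 := by omega
      rw [Nat.sub_self] at h3
      cases x
      · exact absurd h3.1 (by simp)
      · exact ⟨rfl, rfl, by simpa [run_inc] using h3.2⟩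
    · rintro ⟨rfl, rfl, h⟩
      refine ⟨le_rfl, Nat.sub_self _, ?_⟩
      rw [Nat.sub_self]
      exact ⟨rfl, (run_inc ..).2 (by simpa using h)⟩
  · simp [List.mem_replicate]

theorem exists_of_run_blocks {E : ℕ × ℕ → Bool} {R : ℕ → ℕ → Prop} (l : List (ℕ × ℕ))
    (hR : ∀ e ∈ l, E e = true → R e.1 e.2) (r : List (Bool × Bool)) {m : Bool} {k : ℕ}
    (h : Run m k (l.flatMap (fun e => edgeBlock e (E e)) ++ (true, true) :: r)) :
    ∃ k', Relation.ReflTransGen R k k' ∧ Run true k' ((true, true) :: r) := by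
  induction l generalizing m k with
  | nil => exact ⟨k, .refl, (run_delim ..).2 ((run_delim ..).1 h)⟩
  | cons e l ih =>
    have ih' := fun m k => @ih (fun e he => hR e (List.mem_cons_of_mem _ he)) m k
    rw [List.flatMap_cons, List.append_assoc, run_edgeBlock] at h
    rcases h with ⟨h1, rfl, h⟩ | h
    · obtain ⟨k', h2, h3⟩ := ih' _ _ h
      exact ⟨k', h2.head (hR e (List.mem_cons_self ..) h1), h3⟩
    · exact ih' _ _ h

theorem run_blocks_of_run {E : ℕ × ℕ → Bool} (l : List (ℕ × ℕ)) {r : List (Bool × Bool)} {k : ℕ}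
    (h : ∀ m, Run m k r) (m : Bool) : Run m k (l.flatMap (fun e => edgeBlock e (E e)) ++ r) := by
  induction l generalizing m with
  | nil => exact h m
  | cons e l ih =>
    rw [List.flatMap_cons, List.append_assoc, run_edgeBlock]
    exact Or.inr (ih false)

theorem run_blocks_of_edge {E : ℕ × ℕ → Bool} (l : List (ℕ × ℕ)) {r : List (Bool × Bool)}
    {e : ℕ × ℕ} (he : e ∈ l) (hE : E e = true) (h : ∀ m, Run m e.2 r) (m : Bool) :
    Run m e.1 (l.flatMap (fun e => edgeBlock e (E e)) ++ r) := by
  induction l generalizing m with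
  | nil => simp at he
  | cons e' l ih =>
    rw [List.flatMap_cons, List.append_assoc, run_edgeBlock]
    rcases List.mem_cons.1 he with rfl | he
    · exact Or.inl ⟨hE, rfl, run_blocks_of_run l h true⟩
    · exact Or.inr (ih he false)

/-- One pass over `l` contains a block for each edge of `R`, so it can simulate one step of a path
by skipping all other blocks, or none by skipping everything. -/
theorem run_passes_of_within {E : ℕ × ℕ → Bool} {R : ℕ → ℕ → Prop} (l : List (ℕ × ℕ))
    (hR : ∀ u v, R u v → (u, v) ∈ l ∧ E (u, v) = true) {t : ℕ} {r : List (Bool × Bool)}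
    (h : ∀ m, Run m t r) (j k : ℕ) (hk : Within R t j k) (m : Bool) :
    Run m k ((List.replicate j l).flatten.flatMap (fun e => edgeBlock e (E e)) ++ r) := by
  induction j generalizing k m with
  | zero =>
    obtain rfl : k = t := hk
    exact h m
  | succ j ih =>
    rw [List.replicate_succ, List.flatten_cons, List.flatMap_append, List.append_assoc]
    rcases hk with hk | ⟨k', h1, hk⟩
    · exact run_blocks_of_run l (ih k hk) m
    · exact run_blocks_of_edge (e := (k, k')) l (hR k k' h1).1 (hR k k' h1).2 (ih k' hk) m

/-- All pairs of vertices, `N` times. -/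
def edgeList (N : ℕ) : List (ℕ × ℕ) :=
  (List.replicate N (List.range N ×ˢ List.range N)).flatten

/-- The program searching for a path from `s` to `t` in the graph `E` with `N` vertices. -/
def reachProgram (N s t : ℕ) (E : ℕ × ℕ → Bool) : List (Bool × Bool) :=
  List.replicate s (true, false) ++ ((edgeList N).flatMap (fun e => edgeBlock e (E e)) ++
    (true, true) :: List.replicate t (false, false))

theorem run_reachProgram {N s t : ℕ} (ht : t < N) (E : ℕ × ℕ → Bool) :
    Run true 0 (reachProgram N s t E) ↔
      Relation.ReflTransGen (fun u v => u < N ∧ v < N ∧ E (u, v) = true) s t := by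
  -- The final block has to be executed: skipping it ends the program in mode `false`, which is not
  -- successful.
  have hend : ∀ m k, Run m k ((true, true) :: List.replicate t (false, false)) ↔ k = t := by
    intro m k
    rw [run_delim, ← List.append_nil (List.replicate t _), run_dec, run_skip]
    · simp only [Run]
      simp only [true_and, reduceCtorEq, false_and, or_false]
      omega
    · simp [List.mem_replicate]
  rw [reachProgram, run_inc, Nat.zero_add]
  constructor
  · intro h
    obtain ⟨k', h1, h2⟩ := exists_of_run_blocks
      (R := fun u v => u < N ∧ v < N ∧ E (u, v) = true) (edgeList N) (fun e he hE => by
        obtain ⟨l, hl, he⟩ := List.mem_flatten.1 he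
        rw [List.eq_of_mem_replicate hl, List.mem_product] at he
        exact ⟨List.mem_range.1 he.1, List.mem_range.1 he.2, hE⟩) _ h
    rwa [(hend _ _).1 h2] at h1
  · intro h
    exact run_passes_of_within _ (fun u v huv => ⟨List.mem_product.2
      ⟨List.mem_range.2 huv.1, List.mem_range.2 huv.2.1⟩, huv.2.2⟩)
      (fun m => (hend m t).2 rfl) N s (within_of_reflTransGen (fun u v huv => huv.1) ht h) true

/-! ### A Turing machine for counter programs -/

/-- The states of `counterNTM`: the second argument of `rd` is the first bit of the current
command if it has been read. -/
inductive CounterState : Type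
  | rd (take : Bool) (first : Option Bool) : CounterState
  | acc : CounterState

open CounterState in
/-- The actions of `counterNTM`: the new state and the move of the head on the advice tape, whose
position is the value of the counter. -/
def counterNext : CounterState → TapeSym → TapeSym → Set (CounterState × Move)
  | rd true none, .left, _ => {(rd true none, .stay)}
  | rd m none, .bit b, _ => {(rd m (some b), .stay)}
  | rd true none, .right, .left => {(acc, .stay)}
  | rd _ (some true), .bit true, _ => {(rd true none, .stay), (rd false none, .stay)}
  | rd false (some _), .bit _, _ => {(rd false none, .stay)}
  | rd true (some true), .bit false, _ => {(rd true none, .right)}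
  | rd true (some false), .bit false, .bit _ => {(rd true none, .left)}
  | rd true (some false), .bit true, .left => {(rd true none, .stay)}
  | _, _, _ => ∅

/-- A Turing machine that runs counter programs without using the work tape. -/
def counterNTM : NTM where
  Q := CounterState
  Γ := Unit
  finQ := by
    refine Finite.of_surjective (α := Option (Bool × Option Bool))
      (fun o => o.elim .acc fun p => .rd p.1 p.2) ?_
    rintro (⟨m, b⟩ | _)
    · exact ⟨some (m, b), rfl⟩
    · exact ⟨none, rfl⟩
  finΓ := inferInstance
  start := .rd true none
  accept := .acc
  blank := ()
  trans q a b _ := {r | r.2.2.1 = .right ∧ r.2.2.2.2 = .stay ∧ (r.1, r.2.2.2.1) ∈ counterNext q a b}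

/-- A configuration of `counterNTM`. -/
def counterConf (q : CounterState) (i k : ℕ) : counterNTM.Conf := ⟨q, i, k, 0, fun _ => ()⟩

theorem counterNTM_step_iff {u w : List Bool} {q : CounterState} {i k : ℕ}
    {d : counterNTM.Conf} : counterNTM.Step u w (counterConf q i k) d ↔
      ∃ q' ma, (q', ma) ∈ counterNext q (readTape u i) (readTape w k) ∧
        d = counterConf q' (min (i + 1) (u.length + 1)) (min (Move.apply k ma) (w.length + 1)) := by
  obtain ⟨q', i', k', p', f'⟩ := d
  constructor
  · rintro ⟨γ, mi, ma, mw, ⟨rfl, rfl, h⟩, rfl, rfl, rfl, -⟩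
    exact ⟨q', ma, h, rfl⟩
  · rintro ⟨q'', ma, h, e⟩
    cases e
    exact ⟨(), .right, ma, .stay, ⟨rfl, rfl, h⟩, rfl, rfl, rfl, rfl⟩

/-- The accepting state is reachable from a configuration. -/
def CounterAcc (u w : List Bool) (q : CounterState) (i k : ℕ) : Prop :=
  ∃ d, Relation.ReflTransGen (counterNTM.Step u w) (counterConf q i k) d ∧ d.state = .acc

theorem counterAcc_iff {u w : List Bool} {q : CounterState} {i k : ℕ} :
    CounterAcc u w q i k ↔ q = .acc ∨
      ∃ q' ma, (q', ma) ∈ counterNext q (readTape u i) (readTape w k) ∧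
        CounterAcc u w q' (min (i + 1) (u.length + 1)) (min (Move.apply k ma) (w.length + 1)) := by
  constructor
  · rintro ⟨d, h, hd⟩
    rcases Relation.ReflTransGen.cases_head h with rfl | ⟨c, hc, h⟩
    · exact Or.inl hd
    · obtain ⟨q', ma, h', rfl⟩ := counterNTM_step_iff.1 hc
      exact Or.inr ⟨q', ma, h', d, h, hd⟩
  · rintro (rfl | ⟨q', ma, h', d, h, hd⟩)
    · exact ⟨_, .refl, rfl⟩
    · exact ⟨d, h.head (counterNTM_step_iff.2 ⟨q', ma, h', rfl⟩), hd⟩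

theorem readTape_append_cons (l r : List Bool) (b : Bool) :
    readTape (l ++ b :: r) (l.length + 1) = .bit b := by
  simp [readTape]

theorem readTape_length_add_one (l : List Bool) : readTape l (l.length + 1) = .right := by
  simp [readTape]

theorem readTape_replicate {L k : ℕ} (hk : k < L) :
    readTape (List.replicate L false) (k + 1) = .bit false := by
  simp [readTape, hk]

/-- The bits of a program. -/
def programBits {β : Type} (l : List (β × β)) : List β := l.flatMap fun p => [p.1, p.2]

/-- The all-`false` advice is a ruler whose left end marker represents counter value 0. A command
raises the counter by at most one, so `hk` keeps the advice head away from the right end marker. -/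
theorem counterAcc_iff_run {L : ℕ} (r : List (Bool × Bool)) (l : List Bool) (m : Bool) (k : ℕ)
    (hk : k + r.length ≤ L) :
    CounterAcc (l ++ programBits r) (List.replicate L false) (.rd m none) (l.length + 1) k ↔
      Run m k r := by
  induction r generalizing l m k with
  | nil =>
    rw [counterAcc_iff]
    simp only [programBits, List.flatMap_nil, List.append_nil, readTape_length_add_one, Run,
      reduceCtorEq, false_or]
    cases m
    · simp [counterNext]
    · rcases k with _ | k
      · simp only [readTape, counterNext, Set.mem_singleton_iff, Prod.mk.injEq, and_self, iff_true]
        exact ⟨_, _, ⟨rfl, rfl⟩, counterAcc_iff.2 (Or.inl rfl)⟩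
      · simp only [List.length_nil] at hk
        simp [readTape_replicate (show k < L by omega), counterNext]
  | cons p r ih =>
    obtain ⟨b, c⟩ := p
    have e1 : l ++ programBits ((b, c) :: r) = l ++ b :: (c :: programBits r) := rfl
    have e2 : l ++ b :: (c :: programBits r) = (l ++ [b]) ++ c :: programBits r := by simp
    have e3 : (l ++ [b]) ++ c :: programBits r = (l ++ [b, c]) ++ programBits r := by simp
    have n1 : min (l.length + 1 + 1) ((l ++ b :: c :: programBits r).length + 1) =
      (l ++ [b]).length + 1 := by simp
    have n2 : min ((l ++ [b]).length + 1 + 1) ((l ++ [b] ++ c :: programBits r).length + 1) =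
      (l ++ [b, c]).length + 1 := by simp
    simp only [List.length_cons] at hk
    have hk' : min k (L + 1) = k := by omega
    have s1 : CounterAcc (l ++ programBits ((b, c) :: r)) (List.replicate L false) (.rd m none)
        (l.length + 1) k ↔ CounterAcc (l ++ [b] ++ c :: programBits r) (List.replicate L false)
        (.rd m (some b)) ((l ++ [b]).length + 1) k := by
      rw [counterAcc_iff, e1, readTape_append_cons, n1, ← e2]
      cases m <;> simp [counterNext, Move.apply, hk']
    have s2 : ∀ m k, k + r.length ≤ L → (CounterAcc (l ++ [b] ++ c :: programBits r)
        (List.replicate L false) (.rd m none) ((l ++ [b, c]).length + 1) k ↔ Run m k r) :=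
      fun m k hk => by
        rw [e3]
        exact ih _ _ _ hk
    rw [s1, counterAcc_iff, readTape_append_cons, n2]
    simp only [List.length_replicate, reduceCtorEq, false_or]
    generalize (l ++ [b, c]).length + 1 = pos at s2 ⊢
    generalize l ++ [b] ++ c :: programBits r = u at s2 ⊢
    have hzero : readTape (List.replicate L false) 0 = .left := rfl
    have hsucc : ∀ k', k = k' + 1 → readTape (List.replicate L false) (k' + 1) = .bit false :=
      fun k' h => readTape_replicate (by omega)
    cases b <;> cases c <;> cases m <;> rcases k with _ | k
    all_goals
      simp only [hzero, hsucc k rfl, counterNext, Run]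
      simp [Move.apply, and_assoc, or_and_right, exists_or] <;> first
      | exact s2 _ _ (by omega)
      | (rw [min_eq_left (by omega)]; exact s2 _ _ (by omega))
      | (rw [min_eq_left (by omega)]; exact or_congr (s2 _ _ (by omega)) (s2 _ _ (by omega)))
      | exact or_congr (s2 _ _ (by omega)) (s2 _ _ (by omega))

theorem counterNTM_accepts_iff {L : ℕ} (r : List (Bool × Bool)) (hL : r.length ≤ L) :
    counterNTM.Accepts (programBits r) (List.replicate L false) ↔ Run true 0 r := by
  rw [← counterAcc_iff_run (L := L) r [] true 0 (by omega)]
  change CounterAcc _ _ (.rd true none) 0 0 ↔ _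
  -- The first move only takes the input head off the left end marker, to the first bit of the
  -- program.
  rw [counterAcc_iff]
  simp [readTape, counterNext, Move.apply]

theorem counterNTM_usesSpace (u w : List Bool) {s : ℕ} (hs : 0 < s) :
    counterNTM.UsesSpace u w s := by
  intro c hc
  have : c.workPos = 0 := by
    induction hc with
    | refl => rfl
    | tail _ h ih =>
      obtain ⟨γ, mi, ma, mw, ⟨-, rfl, -⟩, -, -, h, -⟩ := h
      exact h.trans ih
  omega

open Classical in
/-- The family of Boolean functions computed by `counterNTM`. -/
noncomputable def counterFamily : BoolFamily := fun n x =>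
  decide (counterNTM.Accepts (List.ofFn x) (List.replicate n false))

theorem counterFamily_mem_NLpoly : counterFamily ∈ NLpoly := by
  refine ⟨counterNTM, fun n => List.replicate n false, .X, 1, fun n => ⟨by simp, fun x => ⟨?_, ?_⟩⟩⟩
  · exact counterNTM_usesSpace _ _ (by omega)
  · simp [counterFamily]

/-- The program `reachProgram` for a graph given by Boolean variables: a bit is either constant or
equal to the variable for an edge. -/
def reachCode (N s t : ℕ) : List ((Bool ⊕ ℕ × ℕ) × (Bool ⊕ ℕ × ℕ)) :=
  List.replicate s (.inl true, .inl false) ++ ((edgeList N).flatMap (fun e =>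
    (.inl true, .inl true) :: (List.replicate e.1 (.inl false, .inl false) ++
      (.inl false, .inl true) :: (.inl false, .inr e) ::
      List.replicate e.2 (.inl true, .inl false))) ++
    (.inl true, .inl true) :: List.replicate t (.inl false, .inl false))

theorem map_reachCode (N s t : ℕ) (E : ℕ × ℕ → Bool) :
    (reachCode N s t).map (Prod.map (Sum.elim id E) (Sum.elim id E)) = reachProgram N s t E := by
  simp [reachCode, reachProgram, edgeBlock, List.map_flatMap]

theorem length_reachCode {N s t : ℕ} (hs : s < N) (ht : t < N) :
    (reachCode N s t).length ≤ N * (N * N * (2 * N + 3)) + 2 * N + 1 := by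
  have h1 : ((edgeList N).flatMap fun e => ((.inl true, .inl true) ::
      (List.replicate e.1 (.inl false, .inl false) ++
      (.inl false, .inl true) :: (.inl false, .inr e) ::
      List.replicate e.2 (.inl true, .inl false)) :
      List ((Bool ⊕ ℕ × ℕ) × (Bool ⊕ ℕ × ℕ)))).length ≤ (edgeList N).length * (2 * N + 3) := by
    rw [List.length_flatMap]
    refine (List.sum_le_card_nsmul _ (2 * N + 3) fun a ha => ?_).trans (by simp)
    obtain ⟨e, he, rfl⟩ := List.mem_map.1 ha
    obtain ⟨l, hl, he⟩ := List.mem_flatten.1 he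
    rw [List.eq_of_mem_replicate hl, List.mem_product, List.mem_range, List.mem_range] at he
    simp only [List.length_cons, List.length_append, List.length_replicate]
    omega
  have h2 : (edgeList N).length = N * (N * N) := by simp [edgeList, List.length_product]
  rw [h2] at h1
  simp only [reachCode, List.length_cons, List.length_append, List.length_replicate] at h1 ⊢
  have : N * (N * N) * (2 * N + 3) = N * (N * N * (2 * N + 3)) := by ring
  omega

theorem length_programBits {β : Type} (l : List (β × β)) : (programBits l).length = 2 * l.length := by
  simp [programBits, List.length_flatMap, mul_comm]

theorem map_programBits {β γ : Type} (f : β → γ) (l : List (β × β)) :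
    (programBits l).map f = programBits (l.map (Prod.map f f)) := by
  simp [programBits, List.map_flatMap, List.flatMap_map]

/-- The graph `E` affects only the values of the guard bits, not the length of the program. Hence
one input length, and one formula, serves all graphs for given `N`, `s`, `t`; `W` tells which inputs
are constants and which are edge variables. -/
theorem exists_reach_formula (h : NLpoly ⊆ PolyFormula) : ∃ P : Polynomial ℕ, ∀ N s t, s < N →
    t < N → ∃ (n : ℕ) (φ : BoolFormula n) (W : Fin n → Bool ⊕ ℕ × ℕ), φ.size ≤ P.eval N ∧
      ∀ E : ℕ × ℕ → Bool, φ.eval (fun i => (W i).elim id E) = true ↔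
        Relation.ReflTransGen (fun u v => u < N ∧ v < N ∧ E (u, v) = true) s t := by
  obtain ⟨P, hP⟩ := h counterFamily_mem_NLpoly
  refine ⟨P.comp (2 * (.X * (.X * .X * (2 * .X + 3)) + 2 * .X + 1)), fun N s t hs ht => ?_⟩
  let W := programBits (reachCode N s t)
  have hW : W.length = 2 * (reachCode N s t).length := length_programBits _
  obtain ⟨φ, h1, h2⟩ := hP W.length
  refine ⟨W.length, φ, W.get, h1.trans ?_, fun E => ?_⟩
  · rw [Polynomial.eval_comp]
    apply polynomial_eval_mono
    rw [hW]
    have := length_reachCode hs ht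
    simpa using this
  · have hx : List.ofFn (fun i => (W.get i).elim id E) = programBits (reachProgram N s t E) := by
      rw [← map_reachCode, ← map_programBits]
      exact (List.map_ofFn (f := W.get) (g := Sum.elim id E)).symm.trans (by rw [List.ofFn_get])
    rw [h2]
    simp only [counterFamily, decide_eq_true_iff]
    rw [hx, counterNTM_accepts_iff, run_reachProgram ht]
    rw [← map_reachCode, List.length_map]
    omega

/-! ### Satisfiability of implication graphs -/

/-- The complementary literal. -/
def litNeg {V : Type} (a : V × Bool) : V × Bool := (a.1, !a.2)

theorem litNeg_litNeg {V : Type} (a : V × Bool) : litNeg (litNeg a) = a := by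
  simp [litNeg]

/-- This is the 2-SAT criterion. An assignment satisfying the implications propagates truth along
paths, so it excludes the cycles. Conversely, a maximal consistent set of literals closed under `E`
decides every variable and is read off as an assignment. -/
theorem exists_assignment_iff {V : Type} [Finite V] {E : V × Bool → V × Bool → Prop}
    (hE : ∀ a b, E a b → E (litNeg b) (litNeg a)) :
    (∃ x : V → Bool, ∀ a b, E a b → x a.1 = a.2 → x b.1 = b.2) ↔
      ∀ v, ¬ (Relation.ReflTransGen E (v, true) (v, false) ∧
        Relation.ReflTransGen E (v, false) (v, true)) := by
  constructor
  · rintro ⟨x, hx⟩ v ⟨h1, h2⟩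
    have key : ∀ a b, Relation.ReflTransGen E a b → x a.1 = a.2 → x b.1 = b.2 := by
      intro a b h ha
      induction h with
      | refl => exact ha
      | tail _ h ih => exact hx _ _ h ih
    cases hv : x v
    · have := key _ _ h2 hv
      simp [hv] at this
    · have := key _ _ h1 hv
      simp [hv] at this
  · intro h
    have hneg : ∀ a b, Relation.ReflTransGen E a b →
        Relation.ReflTransGen E (litNeg b) (litNeg a) := by
      intro a b h
      induction h with
      | refl => exact .refl
      | tail _ h ih => exact ih.head (hE _ _ h)
    have hneg' : ∀ a b, Relation.ReflTransGen E a (litNeg b) →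
        Relation.ReflTransGen E b (litNeg a) := fun a b h => by
      simpa only [litNeg_litNeg] using hneg _ _ h
    obtain ⟨S, ⟨hS1, hS2⟩, hmax⟩ := (Set.toFinite {S : Set (V × Bool) |
      (∀ a b, E a b → a ∈ S → b ∈ S) ∧ ∀ a ∈ S, litNeg a ∉ S}).exists_maximal
      ⟨∅, by simp, by simp⟩
    have hS1' : ∀ a b, Relation.ReflTransGen E a b → a ∈ S → b ∈ S := by
      intro a b h ha
      induction h with
      | refl => exact ha
      | tail _ h ih => exact hS1 _ _ h ih
    -- Everything reachable from `a` is added to `S`. By contraposition a clash with `S` would put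
    -- `litNeg a` into `S`, and a clash among the new literals would give a path from `a` to `litNeg
    -- a`; so maximality yields `a ∈ S`.
    have hadd : ∀ a, ¬ Relation.ReflTransGen E a (litNeg a) → litNeg a ∉ S → a ∈ S := by
      intro a h1 h2
      refine hmax (y := S ∪ {b | Relation.ReflTransGen E a b}) ⟨?_, ?_⟩ Set.subset_union_left
        (Or.inr .refl)
      · rintro b c hbc (hb | hb)
        · exact Or.inl (hS1 _ _ hbc hb)
        · exact Or.inr (hb.tail hbc)
      · rintro b (hb | hb) (hb' | hb')
        · exact hS2 b hb hb'
        · exact h2 (hS1' _ _ (hneg' _ _ hb') hb)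
        · exact h2 (hS1' _ _ (hneg _ _ hb) hb')
        · exact h1 (hb.trans (hneg' _ _ hb'))
    classical
    refine ⟨fun v => decide ((v, true) ∈ S), ?_⟩
    have key : ∀ a : V × Bool, decide ((a.1, true) ∈ S) = a.2 ↔ a ∈ S := by
      rintro ⟨v, _ | _⟩
      · simp only [decide_eq_false_iff_not]
        refine ⟨fun h1 => ?_, fun h1 => by simpa [litNeg] using hS2 _ h1⟩
        by_cases h2 : Relation.ReflTransGen E (v, false) (v, true)
        · by_contra h3
          exact h1 (hadd (v, true) (fun h4 => h v ⟨h4, h2⟩) h3)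
        · exact hadd (v, false) h2 h1
      · simp
    intro a b hab ha
    exact (key b).2 (hS1 a b hab ((key a).1 ha))

/-! ### Homomorphisms from the chase -/

theorem Atom.map_congr {V W : Type} {f g : V → W} {α : Atom V} (h : ∀ x ∈ α.args, f x = g x) :
    α.map f = α.map g := by
  cases α with
  | un p x => exact congrArg (Atom.un p) (h x rfl)
  | bin p x y => exact congrArg₂ (Atom.bin p) (h x (Or.inl rfl)) (h y (Or.inr rfl))

theorem Atom.mem_args_map {V W : Type} {f : V → W} {α : Atom V} {y : W} :
    y ∈ (α.map f).args ↔ ∃ x ∈ α.args, f x = y := by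
  cases α with
  | un p x => simp [Atom.map, Atom.args, eq_comm]
  | bin p x y => simp [Atom.map, Atom.args, eq_comm]

theorem Atom.exists_mem_args {V : Type} (α : Atom V) : ∃ x, x ∈ α.args := by
  cases α with
  | un p x => exact ⟨x, rfl⟩
  | bin p x y => exact ⟨x, Or.inl rfl⟩

theorem IsChase.mem_ind {T : Ontology} {A : Data} {C : Set (Atom (ℕ ⊕ ℕ))}
    (hC : IsChase T A C) {x : ℕ} (hx : Sum.inl x ∈ dom C) : x ∈ A.ind := by
  obtain ⟨I, h0, hstep, rfl, -⟩ := hC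
  obtain ⟨α, hα', hx⟩ := hx
  obtain ⟨k, hα⟩ : ∃ k, α ∈ I k := Set.mem_iUnion.1 hα'
  clear hα'
  induction k generalizing α x with
  | zero =>
    rw [h0] at hα
    obtain ⟨β, hβ, rfl⟩ := hα
    obtain ⟨y, hy, e⟩ := Atom.mem_args_map.1 hx
    cases e
    exact ⟨β, hβ, hy⟩
  | succ k ih =>
    rcases hstep k with h | ⟨τ, hτ, g, hg, -, hnew, h⟩
    · exact ih α hx (h ▸ hα)
    · rw [h] at hα
      rcases hα with hα | ⟨ψ, hψ, rfl⟩
      · exact ih α hx hα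
      · obtain ⟨v, hv, e⟩ := Atom.mem_args_map.1 hx
        by_cases hv' : v ∈ τ.body.args
        · exact ih _ (Atom.mem_args_map.2 ⟨v, hv', e⟩) hg
        · obtain ⟨n, hn, -⟩ := hnew v hv'
          rw [hn] at e
          cases e

/-- Only the value at the fresh null is changed, to the witness found in `M`. The old homomorphism
may have assigned that null arbitrarily, so agreement is claimed only on individuals and on `dom I`.
-/
theorem ChaseStep.exists_hom {T : Ontology} {I J : Set (Atom (ℕ ⊕ ℕ))} (hIJ : ChaseStep T I J)
    {D : Type} {M : Set (Atom D)} (hM : ∀ τ ∈ T, τ.Sat M) (h : ℕ ⊕ ℕ → D)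
    (hI : ∀ α ∈ I, α.map h ∈ M) : ∃ h' : ℕ ⊕ ℕ → D, (∀ α ∈ J, α.map h' ∈ M) ∧
      (∀ n, h' (.inl n) = h (.inl n)) ∧ ∀ x ∈ dom I, h' x = h x := by
  classical
  obtain ⟨τ, hτ, g, hg, -, hnew, rfl⟩ := hIJ
  obtain ⟨g', hg1, hg2⟩ := hM τ hτ (h ∘ g) (by simpa only [← Atom.map_map] using hI _ hg)
  have hdom : ∀ v ∈ τ.body.args, g v ∈ dom I := fun v hv =>
    ⟨_, hg, Atom.mem_args_map.2 ⟨v, hv, rfl⟩⟩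
  have hone : ∀ v w, v ∉ τ.body.args → w ∉ τ.body.args → v = w := by
    intro v w hv hw
    obtain ⟨z, hz⟩ := τ.body.exists_mem_args
    have h1 : v ≠ z := fun e => hv (e ▸ hz)
    have h2 : w ≠ z := fun e => hw (e ▸ hz)
    omega
  let h' : ℕ ⊕ ℕ → D := fun x =>
    if hx : ∃ v, v ∉ τ.body.args ∧ g v = x then g' hx.choose else h x
  have e1 : ∀ x ∈ dom I, h' x = h x := fun x hx => dif_neg (by
    rintro ⟨v, hv, rfl⟩
    obtain ⟨n, hn, hn'⟩ := hnew v hv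
    exact hn' (hn ▸ hx))
  have e2 : ∀ v, h' (g v) = g' v := by
    intro v
    by_cases hv : v ∈ τ.body.args
    · rw [e1 _ (hdom v hv), hg1 v hv]
      rfl
    · have hx : ∃ w, w ∉ τ.body.args ∧ g w = g v := ⟨v, hv, rfl⟩
      rw [show h' (g v) = g' hx.choose from dif_pos hx, hone _ _ hx.choose_spec.1 hv]
  refine ⟨h', ?_, fun n => dif_neg ?_, e1⟩
  · rintro α (hα | ⟨ψ, hψ, rfl⟩)
    · rw [Atom.map_congr fun x hx => e1 x ⟨α, hα, hx⟩]
      exact hI α hα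
    · rw [Atom.map_map, show h' ∘ g = g' from funext e2]
      exact hg2 ψ hψ
  · rintro ⟨v, hv, e⟩
    obtain ⟨m, hm, -⟩ := hnew v hv
    rw [hm] at e
    cases e

/-- The homomorphisms of successive stages agree on the elements already present, so each element
has an eventual value and the limit is a homomorphism of the union. -/
theorem IsChase.exists_hom {T : Ontology} {A : Data} {C : Set (Atom (ℕ ⊕ ℕ))}
    (hC : IsChase T A C) {D : Type} {M : Set (Atom D)} {c : ℕ → D} (hM : IsModel T A M c) :
    ∃ h : ℕ ⊕ ℕ → D, (∀ n, h (.inl n) = c n) ∧ ∀ α ∈ C, α.map h ∈ M := by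
  obtain ⟨I, h0, hstep, rfl, -⟩ := hC
  have hext : ∀ (k : ℕ) (h : ℕ ⊕ ℕ → D), (∀ n, h (.inl n) = c n) → (∀ α ∈ I k, α.map h ∈ M) →
      ∃ h' : ℕ ⊕ ℕ → D, ((∀ n, h' (.inl n) = c n) ∧ ∀ α ∈ I (k + 1), α.map h' ∈ M) ∧
        ∀ x ∈ dom (I k), h' x = h x := by
    intro k h h1 h2
    rcases hstep k with e | e
    · exact ⟨h, ⟨h1, e ▸ h2⟩, fun _ _ => rfl⟩
    · obtain ⟨h', h3, h4, h5⟩ := e.exists_hom hM.1 h h2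
      exact ⟨h', ⟨fun n => (h4 n).trans (h1 n), h3⟩, h5⟩
  choose! F hF1 hF2 using hext
  let H : ℕ → ℕ ⊕ ℕ → D := fun k => Nat.rec (Sum.elim c fun _ => c 0) (fun k h => F k h) k
  have hH : ∀ k, (∀ n, H k (.inl n) = c n) ∧ ∀ α ∈ I k, α.map (H k) ∈ M := by
    intro k
    induction k with
    | zero =>
      refine ⟨fun _ => rfl, fun α hα => ?_⟩
      rw [h0] at hα
      obtain ⟨β, hβ, rfl⟩ := hα
      rw [Atom.map_map]
      exact hM.2 β hβ
    | succ k ih => exact hF1 k (H k) ih.1 ih.2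
  have hI : ∀ k, I k ⊆ I (k + 1) := by
    intro k
    rcases hstep k with e | ⟨τ, -, g, -, -, -, e⟩
    · exact e.symm.subset
    · exact e ▸ Set.subset_union_left
  have hImono : ∀ i j, i ≤ j → dom (I i) ⊆ dom (I j) := by
    rintro i j hij x ⟨α, hα, hx⟩
    exact ⟨α, monotone_nat_of_le_succ hI hij hα, hx⟩
  have hstable : ∀ i j, i ≤ j → ∀ x ∈ dom (I i), H j x = H i x := by
    intro i j hij x hx
    induction hij with
    | refl => rfl
    | @step j hij ih =>
      exact (hF2 j (H j) (hH j).1 (hH j).2 x (hImono i j hij hx)).trans ih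
  classical
  let h : ℕ ⊕ ℕ → D := fun x => if hx : ∃ k, x ∈ dom (I k) then H hx.choose x else H 0 x
  have hh : ∀ k, ∀ x ∈ dom (I k), h x = H k x := by
    intro k x hx
    have hx' : ∃ k, x ∈ dom (I k) := ⟨k, hx⟩
    rw [show h x = H hx'.choose x from dif_pos hx']
    rcases le_total hx'.choose k with hle | hle
    · exact (hstable _ _ hle x hx'.choose_spec).symm
    · exact hstable _ _ hle x hx
  refine ⟨h, fun n => ?_, fun α hα => ?_⟩
  · simp only [h]
    split_ifs
    exacts [(hH _).1 n, (hH 0).1 n]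
  · obtain ⟨k, hα⟩ := Set.mem_iUnion.1 hα
    rw [Atom.map_congr fun x hx => hh k x ⟨α, hα, hx⟩]
    exact (hH k).2 α hα

/-! ### Canonical models of ontologies of depth 1 -/

/-- The formulas `S(x)` and `S(x, x)` with a predicate `S` of the ontology. -/
def Ontology.LoopGen (T : Ontology) (ϱ : Atom (Fin 2)) : Prop :=
  ϱ.pred ∈ T.preds ∧ ∃ p, ϱ = .un p 0 ∨ ϱ = .bin p 0 0

/-- For every `ϱ`, the set `K ϱ` is a universal model of the ontology and `ϱ(a)`, where the element
`a` is `none`; there are no binary atoms connecting the other elements. -/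
structure IsStarModels (T : Ontology) (K : Atom (Fin 2) → Set (Atom (Option ℕ))) : Prop where
  mem : ∀ ϱ, T.LoopGen ϱ → ϱ.map (fun _ => none) ∈ K ϱ
  sat : ∀ ϱ, T.LoopGen ϱ → ∀ τ ∈ T, τ.Sat (K ϱ)
  star : ∀ ϱ, T.LoopGen ϱ → ∀ p i j, Atom.bin p (some i) (some j) ∉ K ϱ
  exists_hom : ∀ ϱ, T.LoopGen ϱ → ∀ (D : Type) (M : Set (Atom D)) (d : D), (∀ τ ∈ T, τ.Sat M) →
    ϱ.map (fun _ => d) ∈ M → ∃ h : Option ℕ → D, h none = d ∧ ∀ α ∈ K ϱ, α.map h ∈ M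

theorem Ontology.body_pred_mem {T : Ontology} {τ : Tgd} (h : τ ∈ T) : τ.body.pred ∈ T.preds :=
  ⟨τ, h, Or.inl rfl⟩

theorem Ontology.head_pred_mem {T : Ontology} {τ : Tgd} (h : τ ∈ T) {ψ : Atom (Fin 2)}
    (hψ : ψ ∈ τ.head) : ψ.pred ∈ T.preds :=
  ⟨τ, h, Or.inr ⟨ψ, hψ, rfl⟩⟩

/-- The models are the generated chases reduced to the predicates of `T`, with the only individual
renamed to `none`. -/
theorem Ontology.IsDepthOne.exists_starModels {T : Ontology} (hT : T.IsDepthOne) :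
    ∃ K, IsStarModels T K := by
  obtain ⟨C, hC, -, hchain⟩ := hT
  have hgen : ∀ ϱ, T.LoopGen ϱ → ϱ ∈ T.generators := by
    rintro ϱ ⟨h, p, rfl | rfl⟩
    · exact ⟨h, p, Or.inl rfl⟩
    · exact ⟨h, p, Or.inr (Or.inl rfl)⟩
  let e : Option ℕ → ℕ ⊕ ℕ := fun o => o.elim (.inl 0) .inr
  let f : ℕ ⊕ ℕ → Option ℕ := Sum.elim (fun _ => none) some
  have hfe : f ∘ e = id := by
    funext o
    cases o <;> rfl
  have hdom : ∀ ϱ, T.LoopGen ϱ → ∀ x ∈ dom (C ϱ), e (f x) = x := by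
    rintro ϱ hϱ (x | x) hx
    · obtain ⟨A, -, -, hA⟩ := hC ϱ (hgen ϱ hϱ)
      have h := hA.mem_ind hx
      have : x = 0 := by simpa [Data.ind, dom, Atom.args] using h
      rw [this]
      rfl
    · rfl
  have hargs : ∀ ϱ, T.LoopGen ϱ → ∀ v ∈ ϱ.args, v = 0 := by
    rintro ϱ ⟨-, p, rfl | rfl⟩ v hv <;> simpa [Atom.args] using hv
  refine ⟨fun ϱ => {α | α.map e ∈ C ϱ ∧ α.pred ∈ T.preds}, ?_, ?_, ?_, ?_⟩
  · intro ϱ hϱ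
    obtain ⟨A, -, -, I, h0, -, rfl', hsat⟩ := hC ϱ (hgen ϱ hϱ)
    refine ⟨?_, by rw [Atom.pred_map]; exact hϱ.1⟩
    obtain ⟨g, hg1, hg2⟩ := hsat ⟨.un A 0, [ϱ]⟩ (Finset.mem_insert_self _ _) (fun _ => .inl 0) (by
      rw [rfl']
      refine Set.mem_iUnion.2 ⟨0, ?_⟩
      rw [h0]
      exact ⟨.un A 0, by simp, rfl⟩)
    rw [Atom.map_map]
    have := hg2 ϱ (List.mem_singleton_self _)
    rwa [Atom.map_congr (g := e ∘ fun _ => none)] at this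
    intro v hv
    rw [hargs ϱ hϱ v hv]
    exact hg1 0 rfl
  · intro ϱ hϱ τ hτ k hk
    obtain ⟨A, -, -, I, -, -, -, hsat⟩ := hC ϱ (hgen ϱ hϱ)
    obtain ⟨g, hg1, hg2⟩ := hsat τ (Finset.mem_insert_of_mem hτ) (e ∘ k) (by
      simpa only [Atom.map_map] using hk.1)
    refine ⟨f ∘ g, fun v hv => ?_, fun ψ hψ => ⟨?_, ?_⟩⟩
    · rw [Function.comp_apply, hg1 v hv]
      exact congrFun hfe (k v)
    · rw [Atom.map_map, Atom.map_congr (g := g)]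
      · exact hg2 ψ hψ
      · exact fun v hv => hdom ϱ hϱ _ ⟨_, hg2 ψ hψ, Atom.mem_args_map.2 ⟨v, hv, rfl⟩⟩
    · rw [Atom.pred_map]
      exact T.head_pred_mem hτ hψ
  · rintro ϱ hϱ p i j ⟨h, -⟩
    -- An atom joining two nulls is traversed back and forth as `j`, `i`, `j`, which makes a
    -- forbidden chain.
    refine hchain ϱ (hgen ϱ hϱ) ⟨fun k => if k = 1 then .inr i else .inr j, fun k hk => ?_⟩
    obtain rfl | rfl : k = 0 ∨ k = 1 := by omega
    · exact ⟨⟨i, rfl⟩, p, Or.inr h⟩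
    · exact ⟨⟨j, rfl⟩, p, Or.inl h⟩
  · intro ϱ hϱ D M d hM hd
    obtain ⟨A, hA, -, hA'⟩ := hC ϱ (hgen ϱ hϱ)
    have hpred : ∀ {a : Atom D}, a.pred ∈ T.preds → a ≠ .un A d := by
      rintro a ha rfl
      exact hA ha
    -- `M` may interpret the auxiliary predicate `A` arbitrarily, so it is reduced to the predicates
    -- of `T` and `A` is made true exactly at `d`.
    obtain ⟨h, h1, h2⟩ := hA'.exists_hom (M := {α | α ∈ M ∧ α.pred ∈ T.preds} ∪ {.un A d})
      (c := fun _ => d) (by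
        constructor
        · intro τ hτ k hk
          rcases Finset.mem_insert.1 hτ with rfl | hτ
          · have hk0 : k 0 = d := by
              rcases hk with hk | hk
              · exact absurd hk.2 hA
              · simpa [Atom.map] using hk
            refine ⟨k, fun _ _ => rfl, fun ψ hψ => Or.inl ?_⟩
            rw [List.mem_singleton.1 hψ]
            refine ⟨?_, by rw [Atom.pred_map]; exact hϱ.1⟩
            rwa [Atom.map_congr (g := fun _ => d)]
            intro v hv
            rw [hargs ϱ hϱ v hv, hk0]
          · rcases hk with hk | hk
            · obtain ⟨g, hg1, hg2⟩ := hM τ hτ k hk.1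
              exact ⟨g, hg1, fun ψ hψ => Or.inl ⟨hg2 ψ hψ, by
                rw [Atom.pred_map]; exact T.head_pred_mem hτ hψ⟩⟩
            · exact absurd hk (hpred (by rw [Atom.pred_map]; exact T.body_pred_mem hτ))
        · intro α hα
          rw [Finset.mem_singleton.1 hα]
          exact Or.inr rfl)
    refine ⟨h ∘ e, h1 0, fun α hα => ?_⟩
    rw [← Atom.map_map]
    refine (h2 _ hα.1).elim And.left fun h => absurd h (hpred ?_)
    rw [Atom.pred_map, Atom.pred_map]
    exact hα.2

/-- The domain of canonical models: individuals and nulls, which are given by an individual `a`, a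
formula `ϱ` and the number of a null in the universal model of `ϱ(a)`. -/
abbrev CanonDom : Type := ℕ ⊕ ℕ × Atom (Fin 2) × ℕ

/-- The embedding of the universal model of `ϱ(a)` into the canonical model. -/
def starMap (a : ℕ) (ϱ : Atom (Fin 2)) : Option ℕ → CanonDom
  | none => .inl a
  | some n => .inr (a, ϱ, n)

/-- The number of a null. -/
def starInv : CanonDom → Option ℕ := Sum.elim (fun _ => none) fun y => some y.2.2

/-- The individual whose universal model contains the element. -/
def canonRoot : CanonDom → ℕ := Sum.elim id fun y => y.1

theorem starInv_starMap (a : ℕ) (ϱ : Atom (Fin 2)) (y : Option ℕ) :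
    starInv (starMap a ϱ y) = y := by
  cases y <;> rfl

theorem canonRoot_starMap (a : ℕ) (ϱ : Atom (Fin 2)) (y : Option ℕ) :
    canonRoot (starMap a ϱ y) = a := by
  cases y <;> rfl

/-- The canonical model: the data with the universal models of `ϱ(a)` for all `ϱ(a)` in the data. -/
def canonModel (T : Ontology) (K : Atom (Fin 2) → Set (Atom (Option ℕ))) (A : Data) :
    Set (Atom CanonDom) :=
  {α | (∃ β ∈ A, α = β.map .inl) ∨ ∃ a ϱ, (T.LoopGen ϱ ∧ ϱ.map (fun _ => a) ∈ A) ∧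
    ∃ β ∈ K ϱ, α = β.map (starMap a ϱ)}

section Canon

variable {T : Ontology} {K : Atom (Fin 2) → Set (Atom (Option ℕ))} {A : Data}

theorem mem_ind_of_map_mem {ϱ : Atom (Fin 2)} {a : ℕ} (h : ϱ.map (fun _ => a) ∈ A) : a ∈ A.ind := by
  obtain ⟨v, hv⟩ := ϱ.exists_mem_args
  exact ⟨_, h, Atom.mem_args_map.2 ⟨v, hv, rfl⟩⟩

theorem canonRoot_mem_ind {y : CanonDom} (h : y ∈ dom (canonModel T K A)) :
    canonRoot y ∈ A.ind := by
  obtain ⟨α, ⟨β, hβ, rfl⟩ | ⟨a, ϱ, ⟨-, ha⟩, β, hβ, rfl⟩, hy⟩ := h <;>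
    obtain ⟨x, hx, rfl⟩ := Atom.mem_args_map.1 hy
  · exact ⟨β, hβ, hx⟩
  · rw [canonRoot_starMap]
    exact mem_ind_of_map_mem ha

theorem exists_of_null_mem_args {α : Atom CanonDom} (hα : α ∈ canonModel T K A) {a n : ℕ}
    {ϱ : Atom (Fin 2)} (h : .inr (a, ϱ, n) ∈ α.args) :
    (T.LoopGen ϱ ∧ ϱ.map (fun _ => a) ∈ A) ∧ ∃ β ∈ K ϱ, α = β.map (starMap a ϱ) := by
  obtain ⟨β, hβ, rfl⟩ | ⟨a', ϱ', ha, β, hβ, rfl⟩ := hα <;>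
    obtain ⟨x, hx, e⟩ := Atom.mem_args_map.1 h
  · cases e
  · cases x with
    | none => cases e
    | some x =>
      cases e
      exact ⟨ha, β, hβ, rfl⟩

theorem null_null_not_mem (hK : IsStarModels T K) (p : ℕ) (s t : ℕ × Atom (Fin 2) × ℕ) :
    Atom.bin p (.inr s) (.inr t) ∉ canonModel T K A := by
  intro h
  obtain ⟨a, ϱ, n⟩ := s
  obtain ⟨⟨hϱ, -⟩, β, hβ, e⟩ := exists_of_null_mem_args h (Or.inl rfl)
  cases β with
  | un p x => cases e
  | bin p' x y =>
    cases x with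
    | none => cases e
    | some x =>
      cases y with
      | none => cases e
      | some y => exact hK.star ϱ hϱ p' x y hβ

theorem exists_hom_canonModel (hK : IsStarModels T K) {D : Type} {M : Set (Atom D)} {c : ℕ → D}
    (hM : IsModel T A M c) :
    ∃ h : CanonDom → D, (∀ n, h (.inl n) = c n) ∧ ∀ α ∈ canonModel T K A, α.map h ∈ M := by
  have hex : ∀ a ϱ, ∃ h : Option ℕ → D, h none = c a ∧
      (T.LoopGen ϱ ∧ ϱ.map (fun _ => a) ∈ A → ∀ α ∈ K ϱ, α.map h ∈ M) := by
    intro a ϱ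
    by_cases ha : T.LoopGen ϱ ∧ ϱ.map (fun _ => a) ∈ A
    · obtain ⟨h, h1, h2⟩ := hK.exists_hom ϱ ha.1 D M (c a) hM.1 (by
        have := hM.2 _ ha.2
        rwa [Atom.map_map] at this)
      exact ⟨h, h1, fun _ => h2⟩
    · exact ⟨fun _ => c a, rfl, fun h => absurd h ha⟩
  choose H H1 H2 using hex
  refine ⟨Sum.elim c fun y => H y.1 y.2.1 (some y.2.2), fun _ => rfl, ?_⟩
  rintro α (⟨β, hβ, rfl⟩ | ⟨a, ϱ, ha, β, hβ, rfl⟩)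
  · rw [Atom.map_map]
    exact hM.2 β hβ
  · rw [Atom.map_map, Atom.map_congr (g := H a ϱ)]
    · exact H2 a ϱ ha β hβ
    · rintro (_ | n) -
      · exact (H1 a ϱ).symm
      · rfl

/-- The canonical model maps into every model, so its atoms over individuals are entailed, and
completeness puts them into the data. -/
theorem mem_of_map_inl_mem (hK : IsStarModels T K) (hA : IsComplete T A) {β : Atom ℕ}
    (h : β.map .inl ∈ canonModel T K A) : β ∈ A := by
  refine hA β (fun x hx => ?_) fun D M c hM => ?_
  · exact canonRoot_mem_ind ⟨_, h, Atom.mem_args_map.2 ⟨x, hx, rfl⟩⟩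
  · obtain ⟨f, hf1, hf2⟩ := exists_hom_canonModel hK hM
    have := hf2 _ h
    rwa [Atom.map_map, show f ∘ Sum.inl = c from funext hf1] at this

/-- A trigger that lifts to a universal model is satisfied. -/
theorem triggerSat_of_lift (hK : IsStarModels T K) {τ : Tgd} (hτ : τ ∈ T) {a : ℕ}
    {ϱ : Atom (Fin 2)} (ha : T.LoopGen ϱ ∧ ϱ.map (fun _ => a) ∈ A) {h : Fin 2 → CanonDom}
    {g : Fin 2 → Option ℕ} (hg : τ.body.map g ∈ K ϱ)
    (hgh : ∀ v ∈ τ.body.args, starMap a ϱ (g v) = h v) : τ.TriggerSat (canonModel T K A) h := by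
  obtain ⟨g', h1, h2⟩ := hK.sat ϱ ha.1 τ hτ g hg
  refine ⟨starMap a ϱ ∘ g', fun v hv => ?_, fun ψ hψ => Or.inr ⟨a, ϱ, ha, _, h2 ψ hψ, ?_⟩⟩
  · rw [Function.comp_apply, h1 v hv, hgh v hv]
  · rw [Atom.map_map]

/-- An atom containing a null lies in the copy of one universal model. Forgetting the root with
`starInv` lifts the whole trigger to that model, where the tgd holds. -/
theorem canonModel_sat_of_null (hK : IsStarModels T K) {τ : Tgd} (hτ : τ ∈ T)
    {h : Fin 2 → CanonDom} (hh : τ.body.map h ∈ canonModel T K A) {v : Fin 2}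
    (hv : v ∈ τ.body.args) {s : ℕ × Atom (Fin 2) × ℕ} (hs : h v = .inr s) :
    τ.TriggerSat (canonModel T K A) h := by
  obtain ⟨a, ϱ, n⟩ := s
  obtain ⟨ha, β, hβ, e⟩ := exists_of_null_mem_args hh (Atom.mem_args_map.2 ⟨v, hv, hs⟩)
  have hβ' : β = τ.body.map (starInv ∘ h) := by
    have := congrArg (Atom.map starInv) e
    rw [Atom.map_map, Atom.map_map, show starInv ∘ starMap a ϱ = id from
      funext (starInv_starMap a ϱ)] at this
    rw [this]
    cases β <;> rfl
  refine triggerSat_of_lift hK hτ ha (hβ' ▸ hβ) fun w hw => ?_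
  have : h w ∈ (β.map (starMap a ϱ)).args := e ▸ Atom.mem_args_map.2 ⟨w, hw, rfl⟩
  obtain ⟨x, -, hx⟩ := Atom.mem_args_map.1 this
  rw [Function.comp_apply, ← hx, starInv_starMap]

theorem canonModel_sat_of_loop (hK : IsStarModels T K) (hA : IsComplete T A) {τ : Tgd}
    (hτ : τ ∈ T) {h : Fin 2 → CanonDom} (hh : τ.body.map h ∈ canonModel T K A) {v : Fin 2}
    (hv : τ.body.args = {v}) {a : ℕ} (ha : h v = .inl a) :
    τ.TriggerSat (canonModel T K A) h := by
  have hpred := T.body_pred_mem hτ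
  have hloop : ∃ ϱ, T.LoopGen ϱ ∧ ∀ (D : Type) (d : D),
      ϱ.map (fun _ => d) = τ.body.map fun _ => d := by
    generalize τ.body = β at hv hpred
    cases β with
    | un p x => exact ⟨.un p 0, ⟨hpred, p, Or.inl rfl⟩, fun _ _ => rfl⟩
    | bin p x y => exact ⟨.bin p 0 0, ⟨hpred, p, Or.inr rfl⟩, fun _ _ => rfl⟩
  obtain ⟨ϱ, hϱ, e⟩ := hloop
  have hmem : τ.body.map (fun _ => a) ∈ A := by
    apply mem_of_map_inl_mem hK hA
    rw [Atom.map_map, Atom.map_congr (g := h)]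
    · exact hh
    · intro w hw
      obtain rfl : w = v := by simpa [hv] using hw
      exact ha.symm
  refine triggerSat_of_lift hK hτ (ϱ := ϱ) (a := a) ⟨hϱ, e ℕ a ▸ hmem⟩ (g := fun _ => none) ?_ ?_
  · rw [← e]
    exact hK.mem ϱ hϱ
  · intro w hw
    obtain rfl : w = v := by simpa [hv] using hw
    exact ha.symm

/-- A trigger touching a null or having a single body variable is satisfied inside one universal
model. Otherwise the body contains both variables, so the tgd has no existential one; its head is
entailed over individuals and lies in the complete data. This is why generators `S(x, y)` with
distinct variables are not needed. -/
theorem isModel_canonModel (hK : IsStarModels T K) (hA : IsComplete T A) :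
    IsModel T A (canonModel T K A) .inl := by
  refine ⟨fun τ hτ h hh => ?_, fun α hα => Or.inl ⟨α, hα, rfl⟩⟩
  by_cases hnull : ∃ v ∈ τ.body.args, ∃ s, h v = .inr s
  · obtain ⟨v, hv, s, hs⟩ := hnull
    exact canonModel_sat_of_null hK hτ hh hv hs
  have hind : ∀ v ∈ τ.body.args, ∃ a, h v = .inl a := by
    intro v hv
    rcases e : h v with a | s
    · exact ⟨a, rfl⟩
    · exact absurd ⟨v, hv, s, e⟩ hnull
  by_cases hone : ∃ v, τ.body.args = {v}
  · obtain ⟨v, hv⟩ := hone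
    obtain ⟨a, ha⟩ := hind v (hv ▸ rfl)
    exact canonModel_sat_of_loop hK hA hτ hh hv ha
  have hall : ∀ v, v ∈ τ.body.args := by
    intro v
    by_contra hv
    obtain ⟨w, hw⟩ := τ.body.exists_mem_args
    refine hone ⟨w, Set.eq_singleton_iff_unique_mem.2 ⟨hw, fun u hu => ?_⟩⟩
    have h1 : u ≠ v := fun e => hv (e ▸ hu)
    have h2 : w ≠ v := fun e => hv (e ▸ hw)
    omega
  choose f hf using fun v => hind v (hall v)
  have hhf : h = Sum.inl ∘ f := funext hf
  subst hhf
  refine ⟨_, fun _ _ => rfl, fun ψ hψ => Or.inl ⟨ψ.map f, ?_, (Atom.map_map ..).symm⟩⟩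
  rw [← Atom.map_map] at hh
  refine hA _ (fun x hx => ?_) fun D M c hM => ?_
  · obtain ⟨v, -, rfl⟩ := Atom.mem_args_map.1 hx
    exact ⟨_, mem_of_map_inl_mem hK hA hh, Atom.mem_args_map.2 ⟨v, hall v, rfl⟩⟩
  · obtain ⟨g, hg1, hg2⟩ := hM.1 τ hτ (c ∘ f) (by
      rw [← Atom.map_map]
      exact hM.2 _ (mem_of_map_inl_mem hK hA hh))
    rw [Atom.map_map, ← show g = c ∘ f from funext fun v => hg1 v (hall v)]
    exact hg2 ψ hψ

theorem certainAnswer_iff_canonModel (hK : IsStarModels T K) (hA : IsComplete T A) {m : ℕ}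
    (q : CQ m) (a : Fin m → ℕ) :
    CertainAnswer T A q a ↔ q.Holds (canonModel T K A) (fun i => .inl (a i)) := by
  refine ⟨fun h => h _ _ _ (isModel_canonModel hK hA), fun ⟨b, hb⟩ D M c hM => ?_⟩
  obtain ⟨f, hf1, hf2⟩ := exists_hom_canonModel hK hM
  refine ⟨f ∘ b, fun α hα => ?_⟩
  have := hf2 _ (hb α hα)
  rw [Atom.map_map] at this
  convert this using 2
  funext v
  rcases v with i | z
  · exact (hf1 _).symm
  · rfl

/-! ### Answers in the canonical model -/

/-- The atoms of the query with the variable `z` are satisfied in the universal model of `ϱ` if `z`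
is mapped to some null and the other variables to the root. -/
def Fits {m : ℕ} (K : Atom (Fin 2) → Set (Atom (Option ℕ))) (q : CQ m) (z : Fin q.numEx)
    (ϱ : Atom (Fin 2)) : Prop :=
  ∃ n, ∀ α ∈ q.atoms, .inr z ∈ α.args →
    α.map (fun v => if v = .inr z then some n else none) ∈ K ϱ

/-- The variable `z` can be mapped to a null with the root `b z`. -/
def Witness {m : ℕ} (T : Ontology) (K : Atom (Fin 2) → Set (Atom (Option ℕ))) (A : Data) (q : CQ m)
    (b : Fin m ⊕ Fin q.numEx → ℕ) (z : Fin q.numEx) : Prop :=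
  (∃ ϱ, T.LoopGen ϱ ∧ Fits K q z ϱ ∧ ϱ.map (fun _ => b (.inr z)) ∈ A) ∧
    ∀ α ∈ q.atoms, .inr z ∈ α.args → ∀ v ∈ α.args, b v = b (.inr z)

/-- The assignment `b` of roots and the set `x` of variables mapped to nulls determine an answer
to the query. -/
structure IsTwoLevelMatch {m : ℕ} (T : Ontology) (K : Atom (Fin 2) → Set (Atom (Option ℕ)))
    (A : Data) (q : CQ m) (b : Fin m ⊕ Fin q.numEx → ℕ) (x : Fin q.numEx → Bool) : Prop where
  indep : ∀ p v w, .bin p v w ∈ q.atoms →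
    ¬ (Sum.elim (fun _ => false) x v = true ∧ Sum.elim (fun _ => false) x w = true)
  mem : ∀ α ∈ q.atoms, (∀ v ∈ α.args, Sum.elim (fun _ => false) x v = false) → α.map b ∈ A
  witness : ∀ z, x z = true → Witness T K A q b z

theorem holds_canonModel_of_match {m : ℕ} {q : CQ m} {b : Fin m ⊕ Fin q.numEx → ℕ}
    {x : Fin q.numEx → Bool} (h : IsTwoLevelMatch T K A q b x) :
    q.Holds (canonModel T K A) (fun i => .inl (b (.inl i))) := by
  have hw := h.witness
  choose ϱ hϱ hfit hmem using fun z hz => (hw z hz).1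
  choose n hn using hfit
  let g : Fin q.numEx → CanonDom := fun z =>
    if hz : x z = true then .inr (b (.inr z), ϱ z hz, n z hz) else .inl (b (.inr z))
  have hroot : ∀ v, Sum.elim (fun _ => false) x v = false →
      Sum.elim (fun i => .inl (b (.inl i))) g v = Sum.inl (b v) := by
    rintro (i | z) hz
    · rfl
    · exact dif_neg (by simpa using hz)
  refine ⟨g, fun α hα => ?_⟩
  by_cases hall : ∀ v ∈ α.args, Sum.elim (fun _ => false) x v = false
  · refine Or.inl ⟨_, h.mem α hα hall, ?_⟩
    rw [Atom.map_map]
    exact Atom.map_congr fun v hv => hroot v (hall v hv)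
  · push Not at hall
    obtain ⟨v, hv, hxv⟩ := hall
    rcases v with i | z
    · exact absurd rfl hxv
    have hz : x z = true := by simpa using hxv
    refine Or.inr ⟨b (.inr z), ϱ z hz, ⟨hϱ z hz, hmem z hz⟩, _, hn z hz α hα hv, ?_⟩
    rw [Atom.map_map]
    refine Atom.map_congr fun w hw' => ?_
    -- By `indep`, any other argument of an atom containing the null variable `z` is an individual,
    -- and by `Witness` it is the root of `z`.
    by_cases hwz : w = .inr z
    · subst hwz
      simp only [Sum.elim_inr, Function.comp_apply, if_true]
      exact dif_pos hz
    · rw [Function.comp_apply, if_neg hwz]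
      refine (hroot w ?_).trans (congrArg Sum.inl ((hw z hz).2 α hα hv w hw'))
      by_contra hxw
      rw [Bool.not_eq_false] at hxw
      cases α with
      | un p u => exact hwz (Eq.trans hw' (Eq.symm hv))
      | bin p u u' =>
        rcases hv with rfl | rfl <;> rcases hw' with rfl | rfl
        · exact hwz rfl
        · exact h.indep _ _ _ hα ⟨hz, hxw⟩
        · exact h.indep _ _ _ hα ⟨hxw, hz⟩
        · exact hwz rfl

theorem exists_match_of_holds_canonModel (hK : IsStarModels T K) (hA : IsComplete T A) {m : ℕ}
    {q : CQ m} (hq : q.atoms ≠ []) {a : Fin m → A.ind}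
    (h : q.Holds (canonModel T K A) (fun i => .inl (a i))) :
    ∃ (b : Fin q.numEx → A.ind) (x : Fin q.numEx → Bool),
      IsTwoLevelMatch T K A q (fun v => (Sum.elim a b v : A.ind)) x := by
  classical
  obtain ⟨β, hβ⟩ := h
  set B : Fin m ⊕ Fin q.numEx → CanonDom := Sum.elim (fun i => .inl (a i)) β with hB
  have hdom : ∀ α ∈ q.atoms, ∀ v ∈ α.args, B v ∈ dom (canonModel T K A) := fun α hα v hv =>
    ⟨_, hβ α hα, Atom.mem_args_map.2 ⟨v, hv, rfl⟩⟩
  obtain ⟨α₀, hα₀⟩ := List.exists_mem_of_ne_nil _ hq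
  obtain ⟨v₀, hv₀⟩ := α₀.exists_mem_args
  -- A variable occurring in no atom may be mapped outside the active domain, so it gets a default
  -- root; an individual for it exists because the query has an atom.
  let d : A.ind := ⟨_, canonRoot_mem_ind (hdom α₀ hα₀ v₀ hv₀)⟩
  let b : Fin q.numEx → A.ind := fun z =>
    if hz : canonRoot (β z) ∈ A.ind then ⟨_, hz⟩ else d
  have hb : ∀ α ∈ q.atoms, ∀ v ∈ α.args, ((Sum.elim a b v : A.ind) : ℕ) = canonRoot (B v) := by
    intro α hα v hv
    have hroot := canonRoot_mem_ind (hdom α hα v hv)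
    rcases v with i | z
    · rfl
    · simp only [Sum.elim_inr, b, hB] at hroot ⊢
      rw [dif_pos hroot]
  -- Variables without atoms never count as nulls, because `Witness` would require a generator in
  -- the data at their root.
  let x : Fin q.numEx → Bool := fun z =>
    decide ((∃ α ∈ q.atoms, .inr z ∈ α.args) ∧ ∃ s, β z = .inr s)
  have hx : ∀ v, Sum.elim (fun _ => false) x v = true → ∃ s, B v = .inr s := by
    rintro (i | z) hz
    · cases hz
    · exact (decide_eq_true_iff.1 (show x z = true from hz)).2
  have hx' : ∀ α ∈ q.atoms, ∀ v ∈ α.args, Sum.elim (fun _ => false) x v = false →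
      B v = .inl (canonRoot (B v)) := by
    intro α hα v hv hz
    rcases v with i | z
    · rfl
    · have h1 := decide_eq_false_iff_not.1 (show x z = false from hz)
      simp only [hB, Sum.elim_inr]
      rcases e : β z with s | s
      · rfl
      · exact absurd ⟨⟨α, hα, hv⟩, s, e⟩ h1
  refine ⟨b, x, ⟨?_, ?_, ?_⟩⟩
  · rintro p v w hα ⟨hv, hw⟩
    obtain ⟨s, hs⟩ := hx v hv
    obtain ⟨t, ht⟩ := hx w hw
    have := hβ _ hα
    rw [Atom.map, hs, ht] at this
    exact null_null_not_mem hK p s t this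
  · intro α hα hall
    apply mem_of_map_inl_mem hK hA
    rw [Atom.map_map, Atom.map_congr (g := B)]
    · exact hβ α hα
    · intro v hv
      rw [hx' α hα v hv (hall v hv), Function.comp_apply, hb α hα v hv]
  · intro z hz
    obtain ⟨⟨α₁, hα₁, hz₁⟩, ⟨r, ϱ, n⟩, hs⟩ := decide_eq_true_iff.1 hz
    have hBz : B (.inr z) = .inr (r, ϱ, n) := hs
    have hroot : ((Sum.elim a b (.inr z) : A.ind) : ℕ) = r := by
      rw [hb α₁ hα₁ _ hz₁, hBz]
      rfl
    obtain ⟨⟨hϱ, hr⟩, -⟩ := exists_of_null_mem_args (hβ α₁ hα₁)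
      (Atom.mem_args_map.2 ⟨_, hz₁, hBz⟩)
    refine ⟨⟨ϱ, hϱ, ⟨n, fun α hα hzα => ?_⟩, by
      simpa only [hroot] using hr⟩, fun α hα hzα v hv => ?_⟩
    · obtain ⟨-, γ, hγ, e⟩ := exists_of_null_mem_args (hβ α hα)
        (Atom.mem_args_map.2 ⟨_, hzα, hBz⟩)
      have hγ' : γ = α.map (starInv ∘ B) := by
        have := congrArg (Atom.map starInv) e
        rw [Atom.map_map, Atom.map_map, show starInv ∘ starMap r ϱ = id from
          funext (starInv_starMap r ϱ)] at this
        rw [this]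
        cases γ <;> rfl
      rw [Atom.map_congr (g := starInv ∘ B)]
      · exact hγ' ▸ hγ
      · intro v hv
        by_cases hvz : v = .inr z
        · rw [hvz, if_pos rfl, Function.comp_apply, hBz]
          rfl
        · rw [if_neg hvz, Function.comp_apply]
          rcases e' : B v with s | s
          · rfl
          · exfalso
            have hmem := hβ α hα
            cases α with
            | un p u => exact hvz (Eq.trans hv (Eq.symm hzα))
            | bin p u u' =>
              rcases hv with rfl | rfl <;> rcases hzα with rfl | rfl
              · exact hvz rfl
              · rw [Atom.map, e', hBz] at hmem
                exact null_null_not_mem hK _ _ _ hmem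
              · rw [Atom.map, e', hBz] at hmem
                exact null_null_not_mem hK _ _ _ hmem
              · exact hvz rfl
    · obtain ⟨-, γ, hγ, e⟩ := exists_of_null_mem_args (hβ α hα)
        (Atom.mem_args_map.2 ⟨_, hzα, hBz⟩)
      have hv' : B v ∈ (γ.map (starMap r ϱ)).args := e ▸ Atom.mem_args_map.2 ⟨v, hv, rfl⟩
      obtain ⟨y, -, hy⟩ := Atom.mem_args_map.1 hv'
      exact (hb α hα v hv).trans ((by rw [← hy, canonRoot_starMap] : _ = r).trans hroot.symm)

theorem certainAnswer_iff_exists_match (hK : IsStarModels T K) (hA : IsComplete T A) {m : ℕ}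
    {q : CQ m} (hq : q.atoms ≠ []) (a : Fin m → A.ind) :
    CertainAnswer T A q (fun i => a i) ↔ ∃ (b : Fin q.numEx → A.ind) (x : Fin q.numEx → Bool),
      IsTwoLevelMatch T K A q (fun v => (Sum.elim a b v : A.ind)) x := by
  rw [certainAnswer_iff_canonModel hK hA]
  exact ⟨exists_match_of_holds_canonModel hK hA hq, fun ⟨_, _, h⟩ => holds_canonModel_of_match h⟩

end Canon

/-! ### The clauses for matches in the canonical model -/

/-- The first and the last argument of an atom. -/
def Atom.ends {V : Type} : Atom V → V × V
  | .un _ x => (x, x)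
  | .bin _ x y => (x, y)

theorem Atom.mem_args_iff {V : Type} {α : Atom V} {x : V} :
    x ∈ α.args ↔ x = α.ends.1 ∨ x = α.ends.2 := by
  cases α <;> simp [Atom.args, Atom.ends]

/-- The Boolean variable for a variable of a query; it is `none` for all answer variables. -/
def nullVar {m k : ℕ} : Fin m ⊕ Fin k → Option (Fin k) := Sum.elim (fun _ => none) some

/-- The disjunctions `c ∨ d` of literals saying that the set of the variables mapped to nulls
determines a match with the roots `b`. -/
def Clause {m : ℕ} (T : Ontology) (K : Atom (Fin 2) → Set (Atom (Option ℕ))) (A : Data) (q : CQ m)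
    (b : Fin m ⊕ Fin q.numEx → ℕ) (c d : Option (Fin q.numEx) × Bool) : Prop :=
  (∃ α ∈ q.atoms, (c = (nullVar α.ends.1, true) ∧ d = (nullVar α.ends.2, true)) ∧ α.map b ∉ A) ∨
  ((∃ p v w, .bin p v w ∈ q.atoms ∧ c = (nullVar v, false) ∧ d = (nullVar w, false)) ∨
    (c = (none, false) ∧ d = (none, false))) ∨
  ∃ z, (c = (some z, false) ∧ d = (some z, false)) ∧ ¬ Witness T K A q b z

/-- The implications given by the clauses. -/
def Implication {m : ℕ} (T : Ontology) (K : Atom (Fin 2) → Set (Atom (Option ℕ))) (A : Data)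
    (q : CQ m) (b : Fin m ⊕ Fin q.numEx → ℕ) (c d : Option (Fin q.numEx) × Bool) : Prop :=
  Clause T K A q b (litNeg c) d ∨ Clause T K A q b d (litNeg c)

section Match

variable {T : Ontology} {K : Atom (Fin 2) → Set (Atom (Option ℕ))} {A : Data} {m : ℕ} {q : CQ m}
  {b : Fin m ⊕ Fin q.numEx → ℕ}

theorem elim_eq_nullVar {k : ℕ} {x : Option (Fin k) → Bool} (h : x none = false)
    (v : Fin m ⊕ Fin k) : Sum.elim (fun _ => false) (fun z => x (some z)) v = x (nullVar v) := by
  rcases v with i | z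
  · exact h.symm
  · rfl

/-- The clauses say that an atom missing from the data must touch a null, that no binary atom has
two nulls, and that a null needs a witness. All answer variables share the Boolean variable `none`,
which a clause of its own makes false; unit conditions repeat their literal to fit the binary
format. -/
theorem exists_match_iff_clauses : (∃ x, IsTwoLevelMatch T K A q b x) ↔
    ∃ x : Option (Fin q.numEx) → Bool, ∀ c d, Clause T K A q b c d → x c.1 = c.2 ∨ x d.1 = d.2 := by
  constructor
  · rintro ⟨x, hx⟩
    have hx' := elim_eq_nullVar (m := m) (x := fun o : Option (Fin q.numEx) => o.elim false x) rfl
    simp only [Option.elim_some] at hx'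
    refine ⟨fun o => o.elim false x, fun c d h => ?_⟩
    rcases h with ⟨α, hα, ⟨rfl, rfl⟩, h⟩ | (⟨p, v, w, hα, rfl, rfl⟩ | ⟨rfl, rfl⟩) |
      ⟨z, ⟨rfl, rfl⟩, h⟩
    · by_contra hne
      simp only [← hx', not_or, Bool.not_eq_true] at hne
      refine h (hx.mem α hα fun v hv => ?_)
      rcases Atom.mem_args_iff.1 hv with rfl | rfl
      · exact hne.1
      · exact hne.2
    · have := hx.indep p v w hα
      simp only [← hx']
      rwa [not_and_or, Bool.not_eq_true, Bool.not_eq_true] at this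
    · exact Or.inl rfl
    · by_contra hne
      simp only [Option.elim_some, or_self, Bool.not_eq_false] at hne
      exact h (hx.witness z hne)
  · rintro ⟨x, hx⟩
    have h0 : x none = false := by
      simpa using hx (none, false) (none, false) (Or.inr (Or.inl (Or.inr ⟨rfl, rfl⟩)))
    have hx' := elim_eq_nullVar (m := m) h0
    refine ⟨fun z => x (some z), ⟨?_, ?_, ?_⟩⟩
    · intro p v w hα
      have := hx _ _ (Or.inr (Or.inl (Or.inl ⟨p, v, w, hα, rfl, rfl⟩)))
      rw [hx', hx', not_and_or, Bool.not_eq_true, Bool.not_eq_true]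
      exact this
    · intro α hα hall
      by_contra h
      have := hx _ _ (Or.inl ⟨α, hα, ⟨rfl, rfl⟩, h⟩)
      simp only [← hx', hall _ (Atom.mem_args_iff.2 (Or.inl rfl)),
        hall _ (Atom.mem_args_iff.2 (Or.inr rfl))] at this
      simp at this
    · intro z hz
      by_contra h
      have := hx _ _ (Or.inr (Or.inr ⟨z, ⟨rfl, rfl⟩, h⟩))
      simp [hz] at this

/-- Each clause contributes both of its contrapositive implications, so the implication graph has
the symmetry that the 2-SAT criterion needs. -/
theorem exists_match_iff : (∃ x, IsTwoLevelMatch T K A q b x) ↔ ∀ v,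
    ¬ (Relation.ReflTransGen (Implication T K A q b) (v, true) (v, false) ∧
      Relation.ReflTransGen (Implication T K A q b) (v, false) (v, true)) := by
  rw [exists_match_iff_clauses, ← exists_assignment_iff]
  · refine exists_congr fun x => ⟨fun h c d hcd hc => ?_, fun h c d hcd => ?_⟩
    · have hc' : x (litNeg c).1 ≠ (litNeg c).2 := by
        simp [litNeg, hc]
      rcases hcd with hcd | hcd
      · exact (h _ _ hcd).resolve_left hc'
      · exact (h _ _ hcd).resolve_right hc'
    · by_cases hc : x c.1 = c.2
      · exact Or.inl hc
      · refine Or.inr (h (litNeg c) d (Or.inl (by rwa [litNeg_litNeg])) ?_)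
        simp only [litNeg]
        exact (Bool.eq_not_of_ne hc)
  · rintro c d (h | h)
    · exact Or.inr (by rwa [litNeg_litNeg])
    · exact Or.inl (by rwa [litNeg_litNeg])

end Match

/-! ### First-order formulas over data instances -/

/-- The value of a formula in a data instance. -/
def Data.Eval (A : Data) {m k : ℕ} (a : Fin m → A.ind) (b : Fin k → A.ind)
    (φ : Voc.BoundedFormula (Fin m) k) : Prop :=
  letI : Voc.Structure A.ind := toStructure {α | α.map Subtype.val ∈ A}
  φ.Realize a b

section FO

variable {A : Data} {m k : ℕ} {a : Fin m → A.ind} {b : Fin k → A.ind}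

theorem Data.models_exs {φ : Voc.BoundedFormula (Fin m) k} :
    A.Models φ.exs a ↔ ∃ b, A.Eval a b φ :=
  letI : Voc.Structure A.ind := toStructure {α | α.map Subtype.val ∈ A}
  FirstOrder.Language.BoundedFormula.realize_exs

theorem Data.eval_bot : A.Eval a b ⊥ ↔ False := Iff.rfl

theorem Data.eval_not {φ : Voc.BoundedFormula (Fin m) k} : A.Eval a b φ.not ↔ ¬ A.Eval a b φ :=
  Iff.rfl

theorem Data.eval_top : A.Eval a b ⊤ ↔ True := by
  let _ : Voc.Structure A.ind := toStructure {α | α.map Subtype.val ∈ A}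
  exact FirstOrder.Language.BoundedFormula.realize_top

theorem Data.eval_sup {φ ψ : Voc.BoundedFormula (Fin m) k} :
    A.Eval a b (φ ⊔ ψ) ↔ A.Eval a b φ ∨ A.Eval a b ψ := by
  let _ : Voc.Structure A.ind := toStructure {α | α.map Subtype.val ∈ A}
  exact FirstOrder.Language.BoundedFormula.realize_sup

theorem Data.eval_inf {φ ψ : Voc.BoundedFormula (Fin m) k} :
    A.Eval a b (φ ⊓ ψ) ↔ A.Eval a b φ ∧ A.Eval a b ψ := by
  let _ : Voc.Structure A.ind := toStructure {α | α.map Subtype.val ∈ A}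
  exact FirstOrder.Language.BoundedFormula.realize_inf

theorem foSize_bot : foSize (⊥ : Voc.BoundedFormula (Fin m) k) = 1 := rfl

theorem foSize_top : foSize (⊤ : Voc.BoundedFormula (Fin m) k) = 3 := rfl

theorem foSize_not (φ : Voc.BoundedFormula (Fin m) k) : foSize φ.not = foSize φ + 2 := rfl

theorem foSize_sup (φ ψ : Voc.BoundedFormula (Fin m) k) :
    foSize (φ ⊔ ψ) = foSize φ + foSize ψ + 3 := by
  change foSize φ + 1 + 1 + foSize ψ + 1 = _
  ring

theorem foSize_inf (φ ψ : Voc.BoundedFormula (Fin m) k) :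
    foSize (φ ⊓ ψ) = foSize φ + foSize ψ + 5 := by
  change foSize φ + (foSize ψ + 1 + 1) + 1 + 1 + 1 = _
  ring

/-- An existential quantifier abbreviates ¬∀¬, and each negation is an implication to falsum: five
symbols. -/
theorem foSize_exs (φ : Voc.BoundedFormula (Fin m) k) : foSize φ.exs = foSize φ + 5 * k := by
  induction k with
  | zero => rfl
  | succ k ih =>
    rw [FirstOrder.Language.BoundedFormula.exs, ih]
    change foSize φ + 1 + 1 + 1 + 1 + 1 + 5 * k = _
    ring

/-- The disjunction of a list of formulas. -/
def listSup (l : List (Voc.BoundedFormula (Fin m) k)) : Voc.BoundedFormula (Fin m) k :=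
  l.foldr (· ⊔ ·) ⊥

theorem Data.eval_listSup {l : List (Voc.BoundedFormula (Fin m) k)} :
    A.Eval a b (listSup l) ↔ ∃ φ ∈ l, A.Eval a b φ := by
  induction l with
  | nil => simp [listSup, Data.eval_bot]
  | cons φ l ih =>
    simp only [listSup, List.foldr_cons, Data.eval_sup, List.exists_mem_cons_iff] at ih ⊢
    rw [ih]

theorem foSize_listSup {s n : ℕ} {l : List (Voc.BoundedFormula (Fin m) k)}
    (h : ∀ φ ∈ l, foSize φ ≤ s) (hn : l.length ≤ n) : foSize (listSup l) ≤ (s + 3) * n + 1 := by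
  have : foSize (listSup l) ≤ (s + 3) * l.length + 1 := by
    clear hn
    induction l with
    | nil => simp [listSup, foSize_bot]
    | cons φ l ih =>
      have h1 := ih fun ψ hψ => h ψ (List.mem_cons_of_mem _ hψ)
      have h2 := h φ (List.mem_cons_self ..)
      simp only [listSup, List.foldr_cons, foSize_sup, List.length_cons] at h1 ⊢
      rw [mul_add]
      omega
  exact this.trans (by gcongr)

/-- An atom as a first-order formula. -/
def atomFO : Atom (Fin m ⊕ Fin k) → Voc.BoundedFormula (Fin m) k
  | .un p v => .rel (VocRel.un p : Voc.Relations 1) fun _ => .var v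
  | .bin p v w => .rel (VocRel.bin p : Voc.Relations 2) ![.var v, .var w]

theorem Data.eval_atomFO {α : Atom (Fin m ⊕ Fin k)} :
    A.Eval a b (atomFO α) ↔ α.map (fun v => (Sum.elim a b v : A.ind).val) ∈ A := by
  cases α <;> rfl

theorem foSize_atomFO (α : Atom (Fin m ⊕ Fin k)) : foSize (atomFO α) ≤ 3 := by
  cases α <;> simp [atomFO, foSize]

/-- The equality of two variables as a first-order formula. -/
def eqFO (v w : Fin m ⊕ Fin k) : Voc.BoundedFormula (Fin m) k := .equal (.var v) (.var w)

theorem Data.eval_eqFO {v w : Fin m ⊕ Fin k} : A.Eval a b (eqFO v w) ↔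
    (Sum.elim a b v : A.ind).val = (Sum.elim a b w : A.ind).val :=
  Subtype.ext_iff

theorem foSize_eqFO (v w : Fin m ⊕ Fin k) : foSize (eqFO v w) = 3 := rfl

/-- Substituting first-order formulas for the variables of a Boolean formula. -/
def substFO {n : ℕ} (ρ : Fin n → Voc.BoundedFormula (Fin m) k) :
    BoolFormula n → Voc.BoundedFormula (Fin m) k
  | .const b => if b then ⊤ else ⊥
  | .var i => ρ i
  | .neg φ => (substFO ρ φ).not
  | .conj φ ψ => substFO ρ φ ⊓ substFO ρ ψ
  | .disj φ ψ => substFO ρ φ ⊔ substFO ρ ψ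

theorem Data.eval_substFO {n : ℕ} {ρ : Fin n → Voc.BoundedFormula (Fin m) k} {x : Fin n → Bool}
    (hx : ∀ i, A.Eval a b (ρ i) ↔ x i = true) (φ : BoolFormula n) :
    A.Eval a b (substFO ρ φ) ↔ φ.eval x = true := by
  induction φ with
  | const c => cases c <;> simp [substFO, BoolFormula.eval, Data.eval_bot, Data.eval_top]
  | var i => exact hx i
  | neg φ ih => simp [substFO, BoolFormula.eval, Data.eval_not, ih]
  | conj φ ψ h1 h2 => simp [substFO, BoolFormula.eval, Data.eval_inf, h1, h2]
  | disj φ ψ h1 h2 => simp [substFO, BoolFormula.eval, Data.eval_sup, h1, h2]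

theorem foSize_substFO {n s : ℕ} {ρ : Fin n → Voc.BoundedFormula (Fin m) k}
    (h : ∀ i, foSize (ρ i) ≤ s) (φ : BoolFormula n) :
    foSize (substFO ρ φ) ≤ φ.size * (s + 5) := by
  induction φ with
  | const c => cases c <;> simp [substFO, BoolFormula.size, foSize_bot, foSize_top]
  | var i => simpa [substFO, BoolFormula.size] using (h i).trans (by omega)
  | neg φ ih =>
    simp only [substFO, BoolFormula.size, foSize_not, add_mul]
    omega
  | conj φ ψ h1 h2 =>
    simp only [substFO, BoolFormula.size, foSize_inf, add_mul]
    omega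
  | disj φ ψ h1 h2 =>
    simp only [substFO, BoolFormula.size, foSize_sup, add_mul]
    omega

end FO

/-! ### The rewriting -/

/-- The list of the formulas `S(x)` and `S(x, x)` with a predicate `S` of the ontology. -/
noncomputable def loopGenList (T : Ontology) : List (Atom (Fin 2)) :=
  T.toList.flatMap fun τ => (τ.body :: τ.head).map fun ψ =>
    match ψ.pred with
    | .inl p => .un p 0
    | .inr p => .bin p 0 0

theorem length_loopGenList (T : Ontology) : (loopGenList T).length = T.size := by
  simp only [loopGenList, List.length_flatMap, List.length_map, List.length_cons, Ontology.size,
    Tgd.size, add_comm 1]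
  exact Finset.sum_map_toList T _

theorem mem_loopGenList {T : Ontology} {ϱ : Atom (Fin 2)} : ϱ ∈ loopGenList T ↔ T.LoopGen ϱ := by
  simp only [loopGenList, List.mem_flatMap, Finset.mem_toList, List.mem_map]
  have key : ∀ τ ψ, ψ ∈ τ.body :: τ.head → τ ∈ T → ψ.pred ∈ T.preds := by
    intro τ ψ hψ hτ
    rcases List.mem_cons.1 hψ with rfl | hψ
    · exact T.body_pred_mem hτ
    · exact T.head_pred_mem hτ hψ
  constructor
  · rintro ⟨τ, hτ, ψ, hψ, rfl⟩
    have := key τ ψ hψ hτ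
    cases ψ with
    | un p x => exact ⟨this, p, Or.inl rfl⟩
    | bin p x y => exact ⟨this, p, Or.inr rfl⟩
  · rintro ⟨⟨τ, hτ, h⟩, p, hϱ⟩
    have : ∃ ψ ∈ τ.body :: τ.head, ϱ.pred = ψ.pred := by
      rcases h with h | ⟨ψ, hψ, h⟩
      · exact ⟨_, List.mem_cons_self .., h⟩
      · exact ⟨ψ, List.mem_cons_of_mem _ hψ, h⟩
    obtain ⟨ψ, hψ, h⟩ := this
    refine ⟨τ, hτ, ψ, hψ, ?_⟩
    rw [← h]
    rcases hϱ with rfl | rfl <;> rfl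

section Rewriting

open Classical in
/-- The formula for `Witness`. -/
noncomputable def witnessFO {m : ℕ} (T : Ontology) (K : Atom (Fin 2) → Set (Atom (Option ℕ)))
    (q : CQ m) (z : Fin q.numEx) : Voc.BoundedFormula (Fin m) q.numEx :=
  listSup (((loopGenList T).filter fun ϱ => Fits K q z ϱ).map fun ϱ =>
    atomFO (ϱ.map fun _ => .inr z)) ⊓
  (listSup (((q.atoms.filter fun α => .inr z ∈ α.args).flatMap fun α =>
    [α.ends.1, α.ends.2]).map fun v => (eqFO v (.inr z)).not)).not

open Classical in
/-- The formula for `Clause`. -/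
noncomputable def clauseFO {m : ℕ} (T : Ontology) (K : Atom (Fin 2) → Set (Atom (Option ℕ)))
    (q : CQ m) (c d : Option (Fin q.numEx) × Bool) : Voc.BoundedFormula (Fin m) q.numEx :=
  listSup ((q.atoms.filter fun α =>
    c = (nullVar α.ends.1, true) ∧ d = (nullVar α.ends.2, true)).map fun α => (atomFO α).not) ⊔
  ((if (∃ p v w, .bin p v w ∈ q.atoms ∧ c = (nullVar v, false) ∧ d = (nullVar w, false)) ∨
    (c = (none, false) ∧ d = (none, false)) then ⊤ else ⊥) ⊔
  listSup (((List.finRange q.numEx).filter fun z =>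
    c = (some z, false) ∧ d = (some z, false)).map fun z => (witnessFO T K q z).not))

/-- The formula for `Implication`. -/
noncomputable def implicationFO {m : ℕ} (T : Ontology)
    (K : Atom (Fin 2) → Set (Atom (Option ℕ))) (q : CQ m) (c d : Option (Fin q.numEx) × Bool) :
    Voc.BoundedFormula (Fin m) q.numEx :=
  clauseFO T K q (litNeg c) d ⊔ clauseFO T K q d (litNeg c)

variable {T : Ontology} {K : Atom (Fin 2) → Set (Atom (Option ℕ))} {A : Data} {m : ℕ} {q : CQ m}
  {a : Fin m → A.ind} {b : Fin q.numEx → A.ind}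

/-- `Fits` does not depend on the data and is settled when the formula is built. The data enter only
through the atoms `ϱ` at the root of `z` and the equalities between roots. -/
theorem Data.eval_witnessFO {z : Fin q.numEx} : A.Eval a b (witnessFO T K q z) ↔
    Witness T K A q (fun v => (Sum.elim a b v : A.ind)) z := by
  rw [witnessFO, Data.eval_inf, Data.eval_not, Data.eval_listSup, Data.eval_listSup]
  simp only [List.mem_map, List.mem_filter, List.mem_flatMap, decide_eq_true_eq, mem_loopGenList,
    exists_exists_and_eq_and, Data.eval_atomFO, Data.eval_not, Data.eval_eqFO, Witness,
    Atom.map_map]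
  refine and_congr ?_ ?_
  · simp only [and_assoc]
    rfl
  · push Not
    constructor
    · rintro h α hα hz v hv
      refine h v ⟨α, ⟨hα, hz⟩, ?_⟩
      simpa [Atom.mem_args_iff] using hv
    · rintro h v ⟨α, ⟨hα, hz⟩, hv⟩
      refine h α hα hz v (Atom.mem_args_iff.2 ?_)
      simpa using hv

theorem Data.eval_clauseFO {c d : Option (Fin q.numEx) × Bool} : A.Eval a b (clauseFO T K q c d) ↔
    Clause T K A q (fun v => (Sum.elim a b v : A.ind)) c d := by
  rw [clauseFO, Data.eval_sup, Data.eval_sup, Data.eval_listSup, Data.eval_listSup]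
  simp only [List.mem_map, List.mem_filter, decide_eq_true_eq, exists_exists_and_eq_and,
    Data.eval_atomFO, Data.eval_not, Data.eval_witnessFO, Clause, List.mem_finRange, true_and]
  refine or_congr (by simp only [and_assoc]) (or_congr ?_ Iff.rfl)
  split_ifs with h
  · exact iff_of_true (Data.eval_top.2 trivial) h
  · exact iff_of_false Data.eval_bot.1 h

theorem Data.eval_implicationFO {c d : Option (Fin q.numEx) × Bool} :
    A.Eval a b (implicationFO T K q c d) ↔
      Implication T K A q (fun v => (Sum.elim a b v : A.ind)) c d := by
  rw [implicationFO, Data.eval_sup, Data.eval_clauseFO, Data.eval_clauseFO, Implication]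

theorem foSize_witnessFO (z : Fin q.numEx) :
    foSize (witnessFO T K q z) ≤ 16 * (q.size + T.size) + 9 := by
  classical
  have h1 := foSize_listSup (s := 3) (n := T.size)
    (l := ((loopGenList T).filter fun ϱ => Fits K q z ϱ).map fun ϱ =>
      (atomFO (ϱ.map fun _ => .inr z) : Voc.BoundedFormula (Fin m) q.numEx)) (by
      intro φ hφ
      obtain ⟨ϱ, -, rfl⟩ := List.mem_map.1 hφ
      exact foSize_atomFO _) (by
      rw [List.length_map, ← length_loopGenList T]
      exact List.length_filter_le ..)
  have h2 := foSize_listSup (s := 5) (n := 2 * q.atoms.length)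
    (l := ((q.atoms.filter fun α => .inr z ∈ α.args).flatMap fun α =>
      [α.ends.1, α.ends.2]).map fun v => (eqFO v (.inr z)).not) (by
      intro φ hφ
      obtain ⟨v, -, rfl⟩ := List.mem_map.1 hφ
      rw [foSize_not, foSize_eqFO]) (by
      rw [List.length_map, List.length_flatMap]
      have := List.length_filter_le (fun α : Atom (Fin m ⊕ Fin q.numEx) =>
        decide (.inr z ∈ α.args)) q.atoms
      simp only [List.length_cons, List.length_nil, List.map_const', List.sum_replicate,
        smul_eq_mul]
      omega)
  rw [witnessFO, foSize_inf, foSize_not]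
  simp only [CQ.size]
  omega

theorem foSize_implicationFO (c d : Option (Fin q.numEx) × Bool) :
    foSize (implicationFO T K q c d) ≤
      32 * (q.size + T.size) ^ 2 + 44 * (q.size + T.size) + 25 := by
  classical
  have key : ∀ c d, foSize (clauseFO T K q c d) ≤
      16 * (q.size + T.size) ^ 2 + 22 * (q.size + T.size) + 11 := by
    intro c d
    have h1 := foSize_listSup (s := 5) (n := q.size + T.size) (l := (q.atoms.filter fun α =>
        c = (nullVar α.ends.1, true) ∧ d = (nullVar α.ends.2, true)).map fun α =>
        (atomFO α).not) (by
        intro φ hφ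
        obtain ⟨α, -, rfl⟩ := List.mem_map.1 hφ
        rw [foSize_not]
        have := foSize_atomFO α
        omega) (by
        rw [List.length_map]
        refine (List.length_filter_le ..).trans ?_
        simp only [CQ.size]
        omega)
    have h2 := foSize_listSup (s := 16 * (q.size + T.size) + 11) (n := q.size + T.size)
        (l := ((List.finRange q.numEx).filter fun z =>
          c = (some z, false) ∧ d = (some z, false)).map fun z => (witnessFO T K q z).not) (by
        intro φ hφ
        obtain ⟨z, -, rfl⟩ := List.mem_map.1 hφ
        rw [foSize_not]
        have := foSize_witnessFO (T := T) (K := K) z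
        omega) (by
        rw [List.length_map]
        refine (List.length_filter_le ..).trans ?_
        rw [List.length_finRange]
        simp only [CQ.size]
        omega)
    have h3 : ∀ p : Prop, [Decidable p] →
        foSize (if p then ⊤ else ⊥ : Voc.BoundedFormula (Fin m) q.numEx) ≤ 3 := by
      intro p _
      split_ifs
      · exact foSize_top.le
      · exact foSize_bot.le.trans (by norm_num)
    rw [clauseFO, foSize_sup, foSize_sup]
    refine (Nat.add_le_add_right (Nat.add_le_add h1 (Nat.add_le_add_right
      (Nat.add_le_add (h3 _) h2) 3)) 3).trans (le_of_eq ?_)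
    ring
  rw [implicationFO, foSize_sup]
  have h1 := key (litNeg c) d
  have h2 := key d (litNeg c)
  omega

end Rewriting

theorem reflTransGen_iff_of_equiv {V : Type} {N : ℕ} (e : V ≃ Fin N) (E : V → V → Prop)
    (F : ℕ × ℕ → Bool) (hF : ∀ u v, F (e u, e v) = true ↔ E u v) (s t : V) :
    Relation.ReflTransGen (fun u v : ℕ => u < N ∧ v < N ∧ F (u, v) = true) (e s) (e t) ↔
      Relation.ReflTransGen E s t := by
  constructor
  · intro h
    suffices H : ∀ k : ℕ, Relation.ReflTransGen
        (fun u v : ℕ => u < N ∧ v < N ∧ F (u, v) = true) (e s) k →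
        ∃ v, (e v : ℕ) = k ∧ Relation.ReflTransGen E s v by
      obtain ⟨v, hv, h⟩ := H _ h
      rwa [e.injective (Fin.ext hv)] at h
    intro k hk
    induction hk with
    | refl => exact ⟨s, rfl, .refl⟩
    | @tail u v _ huv ih =>
      obtain ⟨u, rfl, h⟩ := ih
      obtain ⟨-, hv, huv⟩ := huv
      refine ⟨e.symm ⟨v, hv⟩, by simp, h.tail ((hF _ _).1 ?_)⟩
      simpa using huv
  · exact fun h => h.lift (fun v => (e v : ℕ)) fun u v huv =>
      ⟨(e u).isLt, (e v).isLt, (hF u v).2 huv⟩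

theorem exists_rewriting {P : Polynomial ℕ} (hP : ∀ N s t, s < N → t < N →
      ∃ (n : ℕ) (φ : BoolFormula n) (W : Fin n → Bool ⊕ ℕ × ℕ), φ.size ≤ P.eval N ∧
      ∀ E : ℕ × ℕ → Bool, φ.eval (fun i => (W i).elim id E) = true ↔
        Relation.ReflTransGen (fun u v => u < N ∧ v < N ∧ E (u, v) = true) s t)
    {T : Ontology} {K : Atom (Fin 2) → Set (Atom (Option ℕ))} (hK : IsStarModels T K) {m : ℕ}
    (q : CQ m) (hq : q.atoms ≠ []) : ∃ φ : Voc.Formula (Fin m), IsFORewriting T q φ ∧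
      foSize φ ≤ (2 * (P.eval (2 * (q.size + T.size) + 2) *
        (32 * (q.size + T.size) ^ 2 + 44 * (q.size + T.size) + 30)) + 8) *
        (q.size + T.size + 1) + 3 + 5 * (q.size + T.size) := by
  classical
  set S := q.size + T.size with hS
  have hqS : q.numEx ≤ S := by
    simp only [hS, CQ.size]
    omega
  let V := Option (Fin q.numEx)
  obtain ⟨e⟩ : Nonempty (V × Bool ≃ Fin (2 * (q.numEx + 1))) :=
    ⟨Fintype.equivFinOfCardEq (by simp [V]; ring)⟩
  -- These formulas replace the inputs of the reachability formula: a constant stays constant, and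
  -- an edge variable becomes the definition of the implication between the two literals with these
  -- numbers.
  let ρ : Bool ⊕ ℕ × ℕ → Voc.BoundedFormula (Fin m) q.numEx := Sum.elim (fun c => if c then ⊤ else ⊥)
    fun uv => if h : uv.1 < 2 * (q.numEx + 1) ∧ uv.2 < 2 * (q.numEx + 1) then
      implicationFO T K q (e.symm ⟨uv.1, h.1⟩) (e.symm ⟨uv.2, h.2⟩) else ⊥
  have hρ : ∀ w, foSize (ρ w) ≤ 32 * S ^ 2 + 44 * S + 25 := by
    rintro ((_ | _) | uv)
    · simp only [ρ, Sum.elim_inl, Bool.false_eq_true, if_false, foSize_bot]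
      omega
    · simp only [ρ, Sum.elim_inl, if_true, foSize_top]
      omega
    · simp only [ρ, Sum.elim_inr]
      split_ifs
      · exact foSize_implicationFO _ _
      · rw [foSize_bot]
        omega
  have hreach : ∀ c d : V × Bool, ∃ φ : Voc.BoundedFormula (Fin m) q.numEx,
      foSize φ ≤ P.eval (2 * S + 2) * (32 * S ^ 2 + 44 * S + 30) ∧
      ∀ (A : Data) (a : Fin m → A.ind) (b : Fin q.numEx → A.ind), A.Eval a b φ ↔
        Relation.ReflTransGen (Implication T K A q fun v => (Sum.elim a b v : A.ind)) c d := by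
    intro c d
    obtain ⟨n, φ, W, h1, h2⟩ := hP (2 * (q.numEx + 1)) (e c) (e d) (e c).isLt (e d).isLt
    refine ⟨substFO (fun i => ρ (W i)) φ, ?_, fun A a b => ?_⟩
    · refine (foSize_substFO (fun i => hρ (W i)) φ).trans (Nat.mul_le_mul_right _ (h1.trans ?_))
      exact polynomial_eval_mono P (by omega)
    · let F : ℕ × ℕ → Bool := fun uv => decide (A.Eval a b (ρ (.inr uv)))
      rw [Data.eval_substFO (x := fun i => (W i).elim id F), h2]
      · refine reflTransGen_iff_of_equiv e _ F (fun u v => ?_) c d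
        simp only [F, ρ, decide_eq_true_eq, Sum.elim_inr]
        rw [dif_pos ⟨(e u).isLt, (e v).isLt⟩, Data.eval_implicationFO]
        simp
      · intro i
        rcases W i with (_ | _) | uv
        · simp [ρ, Data.eval_bot]
        · simp [ρ, Data.eval_top]
        · simp [F]
  choose reachFO hsize heval using hreach
  let l : List (Voc.BoundedFormula (Fin m) q.numEx) := (none :: (List.finRange q.numEx).map some).map
    fun v => reachFO (v, true) (v, false) ⊓ reachFO (v, false) (v, true)
  -- The rewriting guesses the roots and denies that some Boolean variable and its negation reach
  -- each other.
  refine ⟨(listSup l).not.exs, fun A hA a => ?_, ?_⟩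
  · rw [Data.models_exs, certainAnswer_iff_exists_match hK hA hq]
    refine exists_congr fun b => ?_
    rw [exists_match_iff, Data.eval_not, Data.eval_listSup]
    simp only [l, List.mem_map, exists_exists_and_eq_and, Data.eval_inf, heval, not_exists, not_and]
    refine ⟨fun h v _ => h v, fun h v => h v ?_⟩
    cases v <;> simp
  · rw [foSize_exs, foSize_not]
    have h1 := foSize_listSup (l := l) (n := S + 1)
      (s := 2 * (P.eval (2 * S + 2) * (32 * S ^ 2 + 44 * S + 30)) + 5) (by
        intro φ hφ
        obtain ⟨v, -, rfl⟩ := List.mem_map.1 hφ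
        rw [foSize_inf]
        have h1 := hsize (v, true) (v, false)
        have h2 := hsize (v, false) (v, true)
        omega) (by
        simp only [l, List.length_map, List.length_cons, List.length_finRange]
        omega)
    rw [show 2 * (P.eval (2 * S + 2) * (32 * S ^ 2 + 44 * S + 30)) + 5 + 3 =
      2 * (P.eval (2 * S + 2) * (32 * S ^ 2 + 44 * S + 30)) + 8 from rfl] at h1
    omega

theorem rewritings_of_NLpoly_subset_PolyFormula (h : NLpoly ⊆ PolyFormula) :
    PolySizeFORewritingsDepthOne := by
  obtain ⟨P, hP⟩ := exists_reach_formula h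
  refine ⟨(2 * (P.comp (2 * .X + 2) * (32 * .X ^ 2 + 44 * .X + 30)) + 8) * (.X + 1) + 3 + 5 * .X,
    fun T m q hT => ?_⟩
  obtain ⟨K, hK⟩ := hT.exists_starModels
  simp only [Polynomial.eval_add, Polynomial.eval_mul, Polynomial.eval_pow, Polynomial.eval_X,
    Polynomial.eval_ofNat, Polynomial.eval_one, Polynomial.eval_comp]
  -- A query without atoms is always true, whereas the guess of roots would fail over the empty data
  -- instance; it is rewritten to `⊤`.
  by_cases hq : q.atoms = []
  · refine ⟨⊤, fun A hA a => iff_of_true ?_ ?_, ?_⟩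
    · intro D I c hI
      exact ⟨fun _ => c 0, fun α hα => by simp [hq] at hα⟩
    · exact Data.eval_top.2 trivial
    · exact foSize_top.le.trans (by omega)
  · exact exists_rewriting hP hK q hq

end OBDA

theorem mainTheorem4 :
    (OBDA.PolySizeFORewritingsDepthOne ↔ OBDA.NLpoly ⊆ OBDA.PolyFormula) ∧
    (OBDA.PolySizeFORewritingsDepthOne ↔ OBDA.NLpoly ⊆ OBDA.NC1) := by
  have h : OBDA.PolySizeFORewritingsDepthOne ↔ OBDA.NLpoly ⊆ OBDA.PolyFormula :=
    ⟨OBDA.NLpoly_subset_PolyFormula_of_rewritings, OBDA.rewritings_of_NLpoly_subset_PolyFormula⟩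
  exact ⟨h, OBDA.NC1_eq_PolyFormula ▸ h⟩
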